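/- \textbf{Corollary.} In the adjacency-matrix model, an undirected simple graph $G$ on a known set $V$ of $n\ge 2$ vertices is accessed through the unitary oracle $O_G|e\rangle|q\rangle=|e\rangle|q\oplus E_G(e)\rangle$, where $e\in\binom V2$, $q\in\{0,1\}$, and $E_G(e)=1$ if and only if $e\in E(G)$. A quantum query algorithm with $T$ queries applies $U_0,O_G,U_1,O_G,\dots,O_G,U_T$ to a fixed initial basis state of a finite-dimensional space, which may contain additional work space on which $O_G$ acts as the identity; the unitaries $U_i$ do not depend on $G$. It then measures in the computational basis and outputs a function of the outcome. The bounded-error quantum query complexity of a function $F$ of $n$-vertex graphs is the least $T$ for which such an algorithm outputs $F(G)$ with probability at least $2/3$ for every $n$-vertex graph $G$. For integers $n\ge 2$ and $k\ge 0$, let $Q(n,k)$ be the bounded-error quantum query complexity of deciding whether an $n$-vertex graph has a matching with at least $k$ edges. Then $Q(n,k)=\Theta(\sqrt{k}\,n)$ when $k=O(n^{2/3})$. Precisely: for every $A>0$ there are constants $c,C>0$, depending only on $A$, such that for all integers $n\ge 2$ and $k\ge 0$ with $k\le A\,n^{2/3}$, \[ Q(n,k)\le C\sqrt{k}\,n,\qquad\text{and,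 if moreover } k\le n/2,\qquad Q(n,k)\ge c\sqrt{k}\,n . \] (The condition $k\le n/2$ holds automatically for $n\ge 8A^3$; for $k>n/2$ no graph has such a matching and $Q(n,k)=0$.) -/

import Mathlib

/-- Unordered pairs of distinct vertices of an `n`-vertex graph: the positions of the adjacency
matrix that can be queried. -/
abbrev VertexPair (n : ℕ) : Type := {e : Sym2 (Fin n) // ¬ e.IsDiag}

open Classical in
/-- The adjacency oracle `E_G : (V choose 2) → {0,1}` of the graph `G`. -/
noncomputable def adjBit {n : ℕ} (G : SimpleGraph (Fin n)) (e : VertexPair n) : Bool :=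
  decide ((e : Sym2 (Fin n)) ∈ G.edgeSet)

/-- Labels `(e, q, z)` of the computational basis: a query register holding a vertex pair `e`, an
answer bit `q`, and a work register of finite dimension `w`. -/
abbrev BasisLabel (n w : ℕ) : Type := VertexPair n × Bool × Fin w

/-- The oracle operator `O_G |e⟩|q⟩|z⟩ = |e⟩|q ⊕ E_G(e)⟩|z⟩`, as it acts on amplitude vectors
(`q ↦ q ⊕ E_G(e)` is an involution; see `applyOracle_single` for the action on basis vectors). -/
noncomputable def applyOracle {n w : ℕ} (G : SimpleGraph (Fin n)) (ψ : BasisLabel n w → ℂ) :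
    BasisLabel n w → ℂ :=
  fun x => ψ (x.1, xor x.2.1 (adjBit G x.1), x.2.2)

theorem applyOracle_single {n w : ℕ} (G : SimpleGraph (Fin n)) (e : VertexPair n) (q : Bool)
    (z : Fin w) :
    applyOracle G (Pi.single ((e, q, z) : BasisLabel n w) (1 : ℂ)) =
      Pi.single ((e, xor q (adjBit G e), z) : BasisLabel n w) (1 : ℂ) := by
  funext x
  obtain ⟨e', q', z'⟩ := x
  simp only [applyOracle, Pi.single_apply, Prod.mk.injEq]
  by_cases h : e' = e
  · subst h
    cases q <;> cases q' <;> cases adjBit G e' <;> simp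
  · simp [h]

/-- A quantum query algorithm `U_0, O, U_1, O, …, O, U_T` on `n`-vertex graphs in the adjacency
matrix model, with outputs in `β`. It starts in a fixed basis state, and at the end the
computational basis is measured and the outcome `x` is answered by `output x`. Nothing here depends
on the input graph. Only the unitaries `U 0, …, U queries` are used. -/
structure QuantumQueryAlgorithm (n : ℕ) (β : Type) where
  /-- the number `T` of oracle calls -/
  queries : ℕ
  /-- the dimension of the work register -/
  workDim : ℕ
  /-- the initial basis state -/
  init : BasisLabel n workDim
  /-- the input-independent unitary operators -/
  U : ℕ → Matrix.unitaryGroup (BasisLabel n workDim) ℂ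
  /-- the answer given on each measurement outcome -/
  output : BasisLabel n workDim → β

namespace QuantumQueryAlgorithm

/-- The state `U_t O_G U_{t-1} ⋯ O_G U_0 |init⟩` reached on input `G` after `t` oracle calls. -/
noncomputable def state {n : ℕ} {β : Type} (A : QuantumQueryAlgorithm n β)
    (G : SimpleGraph (Fin n)) : ℕ → BasisLabel n A.workDim → ℂ
  | 0 => Matrix.mulVec (A.U 0).1 (Pi.single A.init 1)
  | t + 1 => Matrix.mulVec (A.U (t + 1)).1 (applyOracle G (A.state G t))

open Classical in
/-- The probability that the algorithm outputs `b` on input `G`. -/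
noncomputable def outputProb {n : ℕ} {β : Type} (A : QuantumQueryAlgorithm n β)
    (G : SimpleGraph (Fin n)) (b : β) : ℝ :=
  ∑ x : BasisLabel n A.workDim, if A.output x = b then ‖A.state G A.queries x‖ ^ 2 else 0

/-- `A` computes `F` with bounded error: on every input graph `G` it outputs `F G` with probability
at least `2/3`. -/
def Computes {n : ℕ} {β : Type} (A : QuantumQueryAlgorithm n β)
    (F : SimpleGraph (Fin n) → β) : Prop :=
  ∀ G : SimpleGraph (Fin n), 2 / 3 ≤ A.outputProb G (F G)

end QuantumQueryAlgorithm

/-- `Q` is the bounded-error quantum query complexity of `F` in the adjacency matrix model: the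
least number of oracle calls of an algorithm that computes `F` with bounded error. -/
def IsQuantumQueryComplexity {n : ℕ} {β : Type} (F : SimpleGraph (Fin n) → β) (Q : ℕ) : Prop :=
  IsLeast {T : ℕ | ∃ A : QuantumQueryAlgorithm n β, A.queries = T ∧ A.Computes F} Q

/-- `G` has a matching with at least `k` edges. -/
def HasMatchingOfSize {n : ℕ} (G : SimpleGraph (Fin n)) (k : ℕ) : Prop :=
  ∃ M : G.Subgraph, M.IsMatching ∧ k ≤ M.edgeSet.ncard

open Classical in
/-- The decision problem `k`-matching on `n`-vertex graphs. -/
noncomputable def kMatching (n k : ℕ) (G : SimpleGraph (Fin n)) : Bool :=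
  decide (HasMatchingOfSize G k)

/-! Upper bound. A classical decision tree in which a 0-answer is charged `a / 2` and a 1-answer `1
/ (2 * a)` gives a feasible dual adversary solution of the maximal path cost
(`DualAdversary.query`), and a dual solution of cost `W` gives an algorithm with `O(W)` queries
(`DualAdversary.exists_algorithm`). The tree grows a matching greedily. If it stops below `k` edges,
the at most `2k` covered vertices form a vertex cover `S`. All pairs inside `S` are queried, and
then a set `I` of outside vertices is grown, one vertex at a time, with all pairs between `I` and
`S` known. The smallest set `R ⊆ S` of maximal Hall deficiency tells where to look: an edge from `R`
to a new vertex lowers the deficiency, and if there is none, the known edges already contain a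
maximum matching (`exists_known_matching`). On a path the searches meet at most `n ^ 2` non-edges
and `O(k)` edges, and the exhaustive queries cost `O(k ^ 2)`. With `a = √k / n` in the searches the
total is `O(√k n + k ^ 2)`, and `k ^ 2 = O(√k n)` exactly in the range `k = O(n ^ (2/3))`. Lower
bound. The adversary method (`card_le_of_relation`) is applied to matchings with `k - 1` and with
`k` edges, related by adding one edge. The former have `Ω(n ^ 2)` relatives when `4k ≤ n`, the
latter have `k`, whence `Ω(√(k n ^ 2))`. -/

/-! ### Unitaries from equal Gram matrices. -/

theorem exists_linearIsometry_of_inner_eq {E κ : Type*} [NormedAddCommGroup E]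
    [InnerProductSpace ℂ E] [FiniteDimensional ℂ E] (a b : κ → E)
    (h : ∀ i j, inner ℂ (a i) (a j) = inner ℂ (b i) (b j)) :
    ∃ f : E →ₗᵢ[ℂ] E, ∀ i, f (a i) = b i := by
  let Ta : (κ →₀ ℂ) →ₗ[ℂ] E := Finsupp.linearCombination ℂ a
  let Tb : (κ →₀ ℂ) →ₗ[ℂ] E := Finsupp.linearCombination ℂ b
  have hin : ∀ c, inner ℂ (Ta c) (Ta c) = inner ℂ (Tb c) (Tb c) := by
    intro c
    simp only [Ta, Tb, Finsupp.linearCombination_apply, Finsupp.sum, sum_inner, inner_sum,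
      inner_smul_left, inner_smul_right, h]
  have hn : ∀ c, ‖Ta c‖ = ‖Tb c‖ := by
    intro c
    rw [@norm_eq_sqrt_re_inner ℂ, @norm_eq_sqrt_re_inner ℂ, hin]
  -- Equal norms make `Ta c ↦ Tb c` well defined and isometric on the range of `Ta`; in finite
  -- dimension it extends to the whole space.
  have hker : LinearMap.ker Ta ≤ LinearMap.ker Tb := by
    intro c hc
    rw [LinearMap.mem_ker] at hc ⊢
    rw [← norm_eq_zero, ← hn, hc, norm_zero]
  let g : LinearMap.range Ta →ₗ[ℂ] E :=
    ((LinearMap.ker Ta).liftQ Tb hker).comp Ta.quotKerEquivRange.symm.toLinearMap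
  have hg : ∀ c, g ⟨Ta c, LinearMap.mem_range_self Ta c⟩ = Tb c := by
    intro c
    have : Ta.quotKerEquivRange.symm ⟨Ta c, LinearMap.mem_range_self Ta c⟩
        = (LinearMap.ker Ta).mkQ c := by
      rw [LinearEquiv.symm_apply_eq]; rfl
    simp [g, this]
  let gi : LinearMap.range Ta →ₗᵢ[ℂ] E :=
    { g with
      norm_map' := by
        rintro ⟨_, c, rfl⟩
        change ‖g ⟨Ta c, LinearMap.mem_range_self Ta c⟩‖ = ‖Ta c‖
        rw [hg, hn] }
  refine ⟨gi.extend, fun i => ?_⟩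
  have h1 : Ta (Finsupp.single i 1) = a i := by simp [Ta]
  have h2 : Tb (Finsupp.single i 1) = b i := by simp [Tb]
  have := gi.extend_apply ⟨Ta (Finsupp.single i 1), LinearMap.mem_range_self Ta _⟩
  rw [← h2, ← hg, ← h1]
  exact this

/-- This lets an algorithm be described by its intended states alone: an input-independent unitary
exists as soon as inner products between the states of all pairs of inputs match. -/
theorem exists_unitary_of_gram_eq {B κ : Type*} [Fintype B] [DecidableEq B] (a b : κ → B → ℂ)
    (h : ∀ i j, star (a i) ⬝ᵥ a j = star (b i) ⬝ᵥ b j) :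
    ∃ U : Matrix.unitaryGroup B ℂ, ∀ i, Matrix.mulVec U.1 (a i) = b i := by
  obtain ⟨f, hf⟩ := exists_linearIsometry_of_inner_eq
    (fun i => WithLp.toLp 2 (a i)) (fun i => WithLp.toLp 2 (b i)) (fun i j => by
      simpa [EuclideanSpace.inner_eq_star_dotProduct, dotProduct_comm] using h i j)
  let M : Matrix B B ℂ := Matrix.of fun i j => f (EuclideanSpace.basisFun B ℂ j) i
  have hM : ∀ x : B → ℂ, M.mulVec x = WithLp.ofLp (f (WithLp.toLp 2 x)) := by
    intro x
    have hx : WithLp.toLp 2 x = ∑ j, x j • EuclideanSpace.basisFun B ℂ j := by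
      have := (EuclideanSpace.basisFun B ℂ).sum_repr (WithLp.toLp 2 x)
      simpa using this.symm
    rw [hx, map_sum]
    ext i
    simp [Matrix.mulVec, dotProduct, M, mul_comm]
  refine ⟨⟨M, ?_⟩, fun i => ?_⟩
  · rw [Matrix.mem_unitaryGroup_iff']
    ext i j
    have h1 := f.inner_map_map (EuclideanSpace.basisFun B ℂ i) (EuclideanSpace.basisFun B ℂ j)
    rw [(EuclideanSpace.basisFun B ℂ).inner_eq_ite] at h1
    rw [Matrix.one_apply, ← h1, EuclideanSpace.inner_eq_star_dotProduct]
    simp [Matrix.mul_apply, M, dotProduct, mul_comm]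
  · change M.mulVec (a i) = b i
    rw [hM, hf]

theorem unitary_mulVec_dotProduct {B : Type*} [Fintype B] [DecidableEq B]
    (U : Matrix.unitaryGroup B ℂ) (a b : B → ℂ) :
    star (Matrix.mulVec U.1 a) ⬝ᵥ Matrix.mulVec U.1 b = star a ⬝ᵥ b := by
  have h : star U.1 * U.1 = 1 := Matrix.mem_unitaryGroup_iff'.mp U.2
  rw [Matrix.star_mulVec, Matrix.dotProduct_mulVec, Matrix.vecMul_vecMul,
    ← Matrix.star_eq_conjTranspose, h, Matrix.vecMul_one]

theorem dotProduct_star_self_eq {B : Type*} [Fintype B] (a : B → ℂ) :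
    star a ⬝ᵥ a = ((∑ x, ‖a x‖ ^ 2 : ℝ) : ℂ) := by
  simp [dotProduct, ← Complex.normSq_eq_conj_mul_self, Complex.normSq_eq_norm_sq]

theorem unitary_mulVec_sum_sq {B : Type*} [Fintype B] [DecidableEq B]
    (U : Matrix.unitaryGroup B ℂ) (a : B → ℂ) :
    ∑ x, ‖Matrix.mulVec U.1 a x‖ ^ 2 = ∑ x, ‖a x‖ ^ 2 := by
  have := unitary_mulVec_dotProduct U a a
  rw [dotProduct_star_self_eq, dotProduct_star_self_eq] at this
  exact_mod_cast this

/-! ### The oracle as a permutation of basis labels, and normalisation of states. -/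

section Oracle

variable {n w : ℕ}

/-- The involution of the basis labels that the oracle of `G` implements. -/
noncomputable def oraclePerm (G : SimpleGraph (Fin n)) : BasisLabel n w ≃ BasisLabel n w where
  toFun x := (x.1, xor x.2.1 (adjBit G x.1), x.2.2)
  invFun x := (x.1, xor x.2.1 (adjBit G x.1), x.2.2)
  left_inv x := by simp
  right_inv x := by simp

theorem applyOracle_sum_comp (G : SimpleGraph (Fin n)) {M : Type*} [AddCommMonoid M]
    (ψ : BasisLabel n w → ℂ) (f : ℂ → M) :
    ∑ x, f (applyOracle G ψ x) = ∑ x, f (ψ x) :=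
  Equiv.sum_comp (oraclePerm G) fun x => f (ψ x)

theorem applyOracle_sub (G : SimpleGraph (Fin n)) (ψ φ : BasisLabel n w → ℂ) :
    applyOracle G (ψ - φ) = applyOracle G ψ - applyOracle G φ := rfl

end Oracle

namespace QuantumQueryAlgorithm

variable {n : ℕ} {β : Type} (A : QuantumQueryAlgorithm n β) (G : SimpleGraph (Fin n))

theorem sum_sq_state (t : ℕ) : ∑ x, ‖A.state G t x‖ ^ 2 = 1 := by
  induction t with
  | zero =>
    rw [state, unitary_mulVec_sum_sq]
    rw [Finset.sum_eq_single A.init]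
    · simp
    · intro b _ hb; simp [hb]
    · simp
  | succ t ih => rw [state, unitary_mulVec_sum_sq, applyOracle_sum_comp G _ fun z => ‖z‖ ^ 2, ih]

end QuantumQueryAlgorithm

/-! ### Dual adversary solutions and their composition along a decision tree. -/

/-- A feasible solution of cost `W` to the dual of the adversary bound, for the problem of computing
`F` on the inputs in `P`: vectors `v G` with coordinates in `ι`, where coordinate `i` belongs to the
query `q i`, and a label `l G` that determines `F G`. -/
def DualAdversary {n : ℕ} {β : Type} (F : SimpleGraph (Fin n) → β) (P : Set (SimpleGraph (Fin n)))
    (W : ℝ) : Prop :=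
  ∃ (ι L : Type) (_ : Fintype ι) (_ : Fintype L) (q : ι → VertexPair n)
    (v : SimpleGraph (Fin n) → ι → ℝ) (l : SimpleGraph (Fin n) → L) (out : L → β),
    (∀ G ∈ P, out (l G) = F G) ∧ (∀ G ∈ P, ∑ i, v G i ^ 2 ≤ W) ∧
    ∀ G ∈ P, ∀ H ∈ P,
      (l G = l H →
        ∑ i, (bif xor (adjBit G (q i)) (adjBit H (q i)) then 2 * (v G i * v H i) else 0) = 0) ∧
      (l G ≠ l H →
        ∑ i, (bif xor (adjBit G (q i)) (adjBit H (q i)) then 2 * (v G i * v H i) else 0) = 1)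

namespace DualAdversary

variable {n : ℕ} {β : Type} {F : SimpleGraph (Fin n) → β} {P : Set (SimpleGraph (Fin n))} {W : ℝ}

theorem mono {W' : ℝ} (h : DualAdversary F P W) (hW : W ≤ W') : DualAdversary F P W' := by
  obtain ⟨ι, L, _, _, q, v, l, out, h1, h2, h3⟩ := h
  exact ⟨ι, L, ‹_›, ‹_›, q, v, l, out, h1, fun G hG => (h2 G hG).trans hW, h3⟩

theorem of_const (b : β) (h : ∀ G ∈ P, F G = b) (hW : 0 ≤ W) : DualAdversary F P W :=
  ⟨Empty, Unit, inferInstance, inferInstance, Empty.elim, fun _ => Empty.elim, fun _ => (),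
    fun _ => b, fun G hG => (h G hG).symm, by simpa using fun _ _ => hW, by simp⟩

/-- The two branches get disjoint private coordinates and disjoint labels, plus one shared
coordinate for the query `e`. Graphs with different answers overlap only there and contribute `2 *
(c₀ * c₁) = 1`; for equal answers this coordinate drops out. Asking for the label, the leaf of the
tree, rather than the value of `F` is what makes the constraint exact. -/
theorem query (e : VertexPair n) {W₀ W₁ c₀ c₁ : ℝ}
    (h₀ : DualAdversary F {G ∈ P | adjBit G e = false} W₀)
    (h₁ : DualAdversary F {G ∈ P | adjBit G e = true} W₁)
    (hc : 2 * (c₀ * c₁) = 1) (hW₀ : c₀ ^ 2 + W₀ ≤ W) (hW₁ : c₁ ^ 2 + W₁ ≤ W) :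
    DualAdversary F P W := by
  obtain ⟨ι₀, L₀, _, _, q₀, v₀, l₀, out₀, a₀, b₀, d₀⟩ := h₀
  obtain ⟨ι₁, L₁, _, _, q₁, v₁, l₁, out₁, a₁, b₁, d₁⟩ := h₁
  refine ⟨Option (ι₀ ⊕ ι₁), L₀ ⊕ L₁, inferInstance, inferInstance,
    fun i => i.elim e (Sum.elim q₀ q₁),
    fun G i => bif adjBit G e then i.elim c₁ (Sum.elim 0 (v₁ G))
      else i.elim c₀ (Sum.elim (v₀ G) 0),
    fun G => bif adjBit G e then .inr (l₁ G) else .inl (l₀ G), Sum.elim out₀ out₁, ?_, ?_, ?_⟩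
  · intro G hG
    cases hb : adjBit G e
    · simpa [hb] using a₀ G ⟨hG, hb⟩
    · simpa [hb] using a₁ G ⟨hG, hb⟩
  · intro G hG
    cases hb : adjBit G e
    · simpa [hb, Fintype.sum_option] using (add_le_add_right (b₀ G ⟨hG, hb⟩) (c₀ ^ 2)).trans hW₀
    · simpa [hb, Fintype.sum_option] using (add_le_add_right (b₁ G ⟨hG, hb⟩) (c₁ ^ 2)).trans hW₁
  · intro G hG H hH
    cases hb : adjBit G e <;> cases hb' : adjBit H e
    · simpa [Fintype.sum_option, hb, hb'] using d₀ G ⟨hG, hb⟩ H ⟨hH, hb'⟩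
    · simpa [Fintype.sum_option, hb, hb'] using hc
    · simpa [Fintype.sum_option, hb, hb', mul_comm] using hc
    · simpa [Fintype.sum_option, hb, hb'] using d₁ G ⟨hG, hb⟩ H ⟨hH, hb'⟩

end DualAdversary

/-! ### From dual solutions to algorithms: phase kickback and the ideal trajectory. -/

section Embedding

variable {n w : ℕ} {ι L : Type}

open Classical in
/-- Embeds real vectors into the space of an algorithm. A public coordinate sits at the query `e₀`
with the answer qubit in the state `|+⟩`, the private coordinate `i` sits at the query `q i` with
the answer qubit in the state `|-⟩`. -/
noncomputable def embedVec (z : Fin w ≃ L ⊕ ι) (e₀ : VertexPair n) (q : ι → VertexPair n)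
    (c : L ⊕ ι → ℝ) : BasisLabel n w → ℂ := fun x =>
  ((if x.1 = Sum.elim (fun _ => e₀) q (z x.2.2) then
    Sum.elim (fun _ => 1) (fun _ => bif x.2.1 then -1 else 1) (z x.2.2) * (c (z x.2.2) / √2)
    else 0 : ℝ) : ℂ)

/-- Multiplies the private coordinate `i` by the phase `(-1) ^ E_G (q i)`. -/
noncomputable def phaseVec (q : ι → VertexPair n) (G : SimpleGraph (Fin n)) (c : L ⊕ ι → ℝ) :
    L ⊕ ι → ℝ :=
  Sum.elim (fun y => c (.inl y)) fun i => (bif adjBit G (q i) then -1 else 1) * c (.inr i)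

theorem applyOracle_embedVec (z : Fin w ≃ L ⊕ ι) (e₀ : VertexPair n) (q : ι → VertexPair n)
    (G : SimpleGraph (Fin n)) (c : L ⊕ ι → ℝ) :
    applyOracle G (embedVec z e₀ q c) = embedVec z e₀ q (phaseVec q G c) := by
  funext ⟨e, b, x⟩
  simp only [applyOracle, embedVec, phaseVec]
  cases z x with
  | inl y => simp
  | inr i =>
    simp only [Sum.elim_inr]
    by_cases h : e = q i
    · subst h
      cases b <;> cases adjBit G (q i) <;> simp [neg_div]
    · simp [h]

theorem embedVec_sub (z : Fin w ≃ L ⊕ ι) (e₀ : VertexPair n) (q : ι → VertexPair n)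
    (c d : L ⊕ ι → ℝ) :
    embedVec z e₀ q c - embedVec z e₀ q d = embedVec z e₀ q (c - d) := by
  funext x
  simp only [embedVec, Pi.sub_apply, ← Complex.ofReal_sub]
  congr 1
  split_ifs
  · ring
  · ring

theorem embedVec_dotProduct [Fintype ι] [Fintype L] (z : Fin w ≃ L ⊕ ι) (e₀ : VertexPair n)
    (q : ι → VertexPair n) (c d : L ⊕ ι → ℝ) :
    star (embedVec z e₀ q c) ⬝ᵥ embedVec z e₀ q d = ((∑ y, c y * d y : ℝ) : ℂ) := by
  have h : ∀ x : BasisLabel n w, star (embedVec z e₀ q c x) * embedVec z e₀ q d x =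
      ((if x.1 = Sum.elim (fun _ => e₀) q (z x.2.2) then
        c (z x.2.2) * d (z x.2.2) / 2 else 0 : ℝ) : ℂ) := by
    rintro ⟨e, b, x⟩
    simp only [embedVec, Complex.star_def, Complex.conj_ofReal, ← Complex.ofReal_mul]
    congr 1
    split_ifs
    · have h2 : √2 * √2 = 2 := Real.mul_self_sqrt (by norm_num)
      have h3 : (c (z x) / √2) * (d (z x) / √2) = c (z x) * d (z x) / 2 := by
        rw [div_mul_div_comm, h2]
      rw [← h3]
      cases z x <;> cases b <;> simp
    · simp
  simp only [dotProduct, Pi.star_apply, h]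
  rw [← Complex.ofReal_sum]
  congr 1
  rw [Fintype.sum_prod_type_right]
  simp only [Finset.sum_ite_eq', Finset.mem_univ, if_true]
  rw [Fintype.sum_prod_type, Fintype.sum_bool, ← Finset.sum_add_distrib,
    ← Equiv.sum_comp z]
  exact Finset.sum_congr rfl fun x _ => by ring

end Embedding

section Ideal

variable {n w : ℕ} {ι L : Type} [Fintype ι] [Fintype L]

theorem sum_sq_embedVec (z : Fin w ≃ L ⊕ ι) (e₀ : VertexPair n) (q : ι → VertexPair n)
    (c : L ⊕ ι → ℝ) : ∑ x, ‖embedVec z e₀ q c x‖ ^ 2 = ∑ y, c y ^ 2 := by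
  have h := embedVec_dotProduct z e₀ q c c
  rw [dotProduct_star_self_eq] at h
  simpa [sq] using Complex.ofReal_injective h

open Classical in
/-- The vector with amplitude `α` at the start symbol `none`, amplitude `β` at the label `a`, and
private part `u`. -/
noncomputable def labelVec (α β : ℝ) (a : L) (u : ι → ℝ) : Option L ⊕ ι → ℝ :=
  Sum.elim (fun y => y.elim α fun b => if b = a then β else 0) u

theorem labelVec_sum_of_eq (α β : ℝ) (a : L) (u u' : ι → ℝ) :
    ∑ y, labelVec α β a u y * labelVec α β a u' y = α ^ 2 + β ^ 2 + ∑ i, u i * u' i := by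
  simp only [labelVec, Fintype.sum_sum_type, Fintype.sum_option, Sum.elim_inl, Sum.elim_inr,
    Option.elim, sq]
  rw [Finset.sum_eq_single a] <;> simp +contextual

theorem labelVec_sum_of_ne (α β : ℝ) {a a' : L} (h : a ≠ a') (u u' : ι → ℝ) :
    ∑ y, labelVec α β a u y * labelVec α β a' u' y = α ^ 2 + ∑ i, u i * u' i := by
  simp only [labelVec, Fintype.sum_sum_type, Fintype.sum_option, Sum.elim_inl, Sum.elim_inr,
    Option.elim, sq]
  rw [Finset.sum_eq_zero]
  · simp
  · intro b _
    by_cases hb : b = a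
    · simp [hb, h]
    · simp [hb]

omit [Fintype ι] [Fintype L] in
theorem phaseVec_labelVec (q : ι → VertexPair n) (G : SimpleGraph (Fin n)) (α β : ℝ) (a : L)
    (u : ι → ℝ) : phaseVec q G (labelVec α β a u) =
      labelVec α β a fun i => (bif adjBit G (q i) then -1 else 1) * u i := by
  funext y
  cases y <;> rfl

end Ideal

/-- The private part `v G / √K` acts as a catalyst. In the presence of it, each query lowers the
inner product of states with different labels by exactly `1 / K` and keeps it for equal labels,
which is what moving weight `1 / K` from the start symbol to the label requires. The catalyst is
missing at the start and superfluous at the end, and its squared norm `W / K ≤ 1 / 12` is the only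
source of error. -/
theorem DualAdversary.exists_algorithm {n : ℕ} {β : Type} {F : SimpleGraph (Fin n) → β} {W : ℝ}
    (e₀ : VertexPair n) (h : DualAdversary F Set.univ W) {K : ℕ} (hK : 0 < K) (hW : 12 * W ≤ K) :
    ∃ A : QuantumQueryAlgorithm n β, A.queries = K ∧ A.Computes F := by
  classical
  obtain ⟨ι, L, _, _, q, v, l, out, hout, hcost, hdual⟩ := h
  have hK' : (0 : ℝ) < K := by exact_mod_cast hK
  let z : Fin (Fintype.card (Option L ⊕ ι)) ≃ Option L ⊕ ι := (Fintype.equivFin _).symm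
  let emb := embedVec z e₀ q
  let u : SimpleGraph (Fin n) → ι → ℝ := fun G i => v G i / √K
  let Ψ : ℕ → SimpleGraph (Fin n) → Option L ⊕ ι → ℝ := fun t G =>
    labelVec (√((K - t) / K)) (√(t / K)) (l G) (u G)
  let start : Option L ⊕ ι → ℝ := labelVec 1 0 (l ⊥) 0
  have hu : ∀ G, ∑ i, u G i ^ 2 ≤ 1 / 12 := by
    intro G
    have h1 : ∑ i, u G i ^ 2 = (∑ i, v G i ^ 2) / K := by
      simp only [u, div_pow, Real.sq_sqrt hK'.le, Finset.sum_div]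
    rw [h1, div_le_iff₀ hK']
    linarith [hcost G trivial]
  let init : BasisLabel n (Fintype.card (Option L ⊕ ι)) := (e₀, false, z.symm (.inl none))
  obtain ⟨U₀, hU₀⟩ := exists_unitary_of_gram_eq (κ := Unit)
    (fun _ => Pi.single init (1 : ℂ)) (fun _ => emb start) (fun _ _ => by
      rw [embedVec_dotProduct, labelVec_sum_of_eq]
      simp)
  have hstep : ∀ t : ℕ, ∃ U : Matrix.unitaryGroup (BasisLabel n (Fintype.card (Option L ⊕ ι))) ℂ,
      t < K → ∀ G, Matrix.mulVec U.1 (applyOracle G (emb (Ψ t G))) = emb (Ψ (t + 1) G) := by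
    intro t
    by_cases ht : t < K
    · obtain ⟨U, hU⟩ := exists_unitary_of_gram_eq
        (fun G => applyOracle G (emb (Ψ t G))) (fun G => emb (Ψ (t + 1) G)) (by
          intro G H
          have ht' : (t : ℝ) + 1 ≤ K := by exact_mod_cast ht
          have s1 : √(((K : ℝ) - t) / K) ^ 2 = (K - t) / K :=
            Real.sq_sqrt (div_nonneg (by linarith) hK'.le)
          have s2 : √((t : ℝ) / K) ^ 2 = t / K := Real.sq_sqrt (by positivity)
          have s3 : √(((K : ℝ) - (t + 1)) / K) ^ 2 = (K - (t + 1)) / K :=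
            Real.sq_sqrt (div_nonneg (by linarith) hK'.le)
          have s4 : √(((t : ℝ) + 1) / K) ^ 2 = (t + 1) / K := Real.sq_sqrt (by positivity)
          -- The two phases cancel unless the answers differ; then the sign flips and the difference
          -- is twice the product.
          have hsum : ∑ i, u G i * u H i - ∑ i, ((bif adjBit G (q i) then -1 else 1) * u G i) *
              ((bif adjBit H (q i) then -1 else 1) * u H i) =
              (∑ i, (bif xor (adjBit G (q i)) (adjBit H (q i)) then
                2 * (v G i * v H i) else 0)) / K := by
            rw [← Finset.sum_sub_distrib, Finset.sum_div]
            refine Finset.sum_congr rfl fun i _ => ?_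
            have h2 : u G i * u H i = v G i * v H i / K := by
              simp only [u]
              rw [div_mul_div_comm, Real.mul_self_sqrt hK'.le]
            cases adjBit G (q i) <;> cases adjBit H (q i) <;> simp [h2] <;> ring
          simp only [emb, Ψ, applyOracle_embedVec, embedVec_dotProduct, phaseVec_labelVec]
          congr 1
          by_cases hl : l G = l H
          · have hd := (hdual G trivial H trivial).1 hl
            rw [hd, zero_div] at hsum
            rw [hl, labelVec_sum_of_eq, labelVec_sum_of_eq]
            push_cast
            rw [s1, s2, s3, s4, ← sub_eq_zero.mp hsum]
            ring
          · have hd := (hdual G trivial H trivial).2 hl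
            rw [hd] at hsum
            rw [labelVec_sum_of_ne _ _ hl, labelVec_sum_of_ne _ _ hl]
            push_cast
            rw [s1, s3, sub_eq_iff_eq_add.mp hsum]
            ring)
      exact ⟨U, fun _ => hU⟩
    · exact ⟨1, fun h => absurd h ht⟩
  choose U hU using hstep
  let A : QuantumQueryAlgorithm n β :=
    { queries := K
      workDim := Fintype.card (Option L ⊕ ι)
      init := init
      U := fun t => Nat.casesOn t U₀ U
      -- `F ⊥` is a dummy answer: the vector `goal` below vanishes on those outcomes.
      output := fun x => Sum.elim (fun y => y.elim (F ⊥) out) (fun _ => F ⊥) (z x.2.2) }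
  refine ⟨A, rfl, fun G => ?_⟩
  have hclose : ∀ t ≤ K, ∑ x, ‖(A.state G t - emb (Ψ t G)) x‖ ^ 2 ≤ 1 / 12 := by
    intro t
    induction t with
    | zero =>
      intro _
      have h0 : A.state G 0 = emb start := hU₀ ()
      have h1 : start - Ψ 0 G = labelVec 0 0 (l G) (-u G) := by
        funext y
        rcases y with (_ | a) | i <;> simp [start, Ψ, labelVec, hK'.ne']
      rw [h0, embedVec_sub, sum_sq_embedVec, h1]
      simp only [sq, labelVec_sum_of_eq]
      simpa [sq] using hu G
    | succ t ih =>
      intro ht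
      have h1 : A.state G (t + 1) - emb (Ψ (t + 1) G) =
          Matrix.mulVec (U t).1 (applyOracle G (A.state G t - emb (Ψ t G))) := by
        rw [applyOracle_sub, Matrix.mulVec_sub, hU t ht G]
        rfl
      rw [h1, unitary_mulVec_sum_sq, applyOracle_sum_comp G _ fun z => ‖z‖ ^ 2]
      exact ih (by omega)
  let goal : Option L ⊕ ι → ℝ := labelVec 0 1 (l G) 0
  have hgoal : ∑ x, ‖(emb (Ψ K G) - emb goal) x‖ ^ 2 ≤ 1 / 12 := by
    have h1 : Ψ K G - goal = labelVec 0 0 (l G) (u G) := by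
      funext y
      rcases y with (_ | a) | i <;> simp [goal, Ψ, labelVec, hK'.ne']
    rw [embedVec_sub, sum_sq_embedVec, h1]
    simp only [sq, labelVec_sum_of_eq]
    simpa [sq] using hu G
  have hbad : ∀ x, A.output x ≠ F G → emb goal x = 0 := by
    rintro ⟨e, b, x⟩ hx
    simp only [A] at hx
    have : goal (z x) = 0 := by
      cases hz : z x with
      | inr i => rfl
      | inl y =>
        cases y with
        | none => rfl
        | some a =>
          rw [hz] at hx
          have ha : a ≠ l G := by
            rintro rfl
            exact hx (hout G trivial)
          simp [goal, labelVec, ha]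
    simp [emb, embedVec, this]
  have hsplit : A.outputProb G (F G) + ∑ x, (if A.output x = F G then 0
      else ‖A.state G K x‖ ^ 2) = 1 := by
    rw [← A.sum_sq_state G K, QuantumQueryAlgorithm.outputProb, ← Finset.sum_add_distrib]
    refine Finset.sum_congr rfl fun x _ => ?_
    have hq : A.queries = K := rfl
    rw [hq]
    by_cases hx : A.output x = F G <;> simp [hx]
  -- Wrong outcomes have amplitude `0` in `goal`, so their probability is at most `2 * (1 / 12 + 1 /
  -- 12) = 1 / 3`.
  have hle : ∑ x, (if A.output x = F G then 0 else ‖A.state G K x‖ ^ 2) ≤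
      ∑ x, (2 * ‖(A.state G K - emb (Ψ K G)) x‖ ^ 2 + 2 * ‖(emb (Ψ K G) - emb goal) x‖ ^ 2) := by
    refine Finset.sum_le_sum fun x _ => ?_
    split_ifs with hx
    · positivity
    · have h1 : A.state G K x = (A.state G K - emb (Ψ K G)) x + (emb (Ψ K G) - emb goal) x := by
        simp [hbad x hx]
      have h2 := norm_add_le ((A.state G K - emb (Ψ K G)) x) ((emb (Ψ K G) - emb goal) x)
      rw [← h1] at h2
      nlinarith [norm_nonneg (A.state G K x),
        sq_nonneg (‖(A.state G K - emb (Ψ K G)) x‖ - ‖(emb (Ψ K G) - emb goal) x‖)]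
  rw [Finset.sum_add_distrib, ← Finset.mul_sum, ← Finset.mul_sum] at hle
  linarith [hclose K le_rfl]

/-! ### Matchings as sets of pairwise disjoint vertex pairs. -/

section Matchings

variable {n : ℕ}

/-- The vertex pairs in `M` are pairwise disjoint. -/
def IsPairMatching (M : Finset (VertexPair n)) : Prop :=
  ∀ e ∈ M, ∀ f ∈ M, ∀ a, a ∈ (e : Sym2 (Fin n)) → a ∈ (f : Sym2 (Fin n)) → e = f

theorem adjBit_eq_true {G : SimpleGraph (Fin n)} {e : VertexPair n} :
    adjBit G e = true ↔ (e : Sym2 (Fin n)) ∈ G.edgeSet := by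
  simp [adjBit]

theorem IsPairMatching.mono {M M' : Finset (VertexPair n)} (h : IsPairMatching M) (hM : M' ⊆ M) :
    IsPairMatching M' := fun e he f hf => h e (hM he) f (hM hf)

theorem IsPairMatching.insert {M : Finset (VertexPair n)} (h : IsPairMatching M) {e : VertexPair n}
    (he : ∀ a ∈ (e : Sym2 (Fin n)), ∀ f ∈ M, a ∉ (f : Sym2 (Fin n))) :
    IsPairMatching (insert e M) := by
  intro f hf g hg a haf hag
  rw [Finset.mem_insert] at hf hg
  rcases hf with rfl | hf
  · rcases hg with rfl | hg
    · rfl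
    · exact absurd hag (he a haf g hg)
  · rcases hg with rfl | hg
    · exact absurd haf (he a hag f hf)
    · exact h f hf g hg a haf hag

theorem hasMatchingOfSize_iff {G : SimpleGraph (Fin n)} {k : ℕ} :
    HasMatchingOfSize G k ↔ ∃ M : Finset (VertexPair n), (∀ e ∈ M, adjBit G e = true) ∧
      IsPairMatching M ∧ k ≤ M.card := by
  classical
  constructor
  · rintro ⟨M, hM, hk⟩
    refine ⟨Finset.univ.filter fun e => (e : Sym2 (Fin n)) ∈ M.edgeSet, ?_, ?_, ?_⟩
    · intro e he
      rw [adjBit_eq_true]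
      exact M.edgeSet_subset (Finset.mem_filter.mp he).2
    · rintro ⟨e, he'⟩ he ⟨f, hf'⟩ hf a hae haf
      replace he := (Finset.mem_filter.mp he).2
      replace hf := (Finset.mem_filter.mp hf).2
      obtain ⟨b, rfl⟩ := Sym2.mem_iff_exists.mp hae
      obtain ⟨c, rfl⟩ := Sym2.mem_iff_exists.mp haf
      have hb : M.Adj a b := he
      have hc : M.Adj a c := hf
      have := hM.eq_of_adj_left hb hc
      subst this
      rfl
    · refine hk.trans ?_
      rw [← Finset.card_map (Function.Embedding.subtype _), ← Set.ncard_coe_finset]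
      refine Set.ncard_le_ncard ?_ (Finset.finite_toSet _)
      intro e he
      have hd : ¬ e.IsDiag := G.not_isDiag_of_mem_edgeSet (M.edgeSet_subset he)
      simp only [Finset.coe_map, Function.Embedding.subtype_apply, Set.mem_image, Finset.mem_coe,
        Finset.mem_filter, Finset.mem_univ, true_and]
      exact ⟨⟨e, hd⟩, he, rfl⟩
  · rintro ⟨M, hG, hM, hk⟩
    let H : G.Subgraph :=
      { verts := {a | ∃ e ∈ M, a ∈ (e : Sym2 (Fin n))}
        Adj := fun a b => ∃ e ∈ M, (e : Sym2 (Fin n)) = s(a, b)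
        adj_sub := by
          rintro a b ⟨e, he, hab⟩
          have := adjBit_eq_true.mp (hG e he)
          rwa [hab] at this
        edge_vert := by
          rintro a b ⟨e, he, hab⟩
          exact ⟨e, he, by rw [hab]; exact Sym2.mem_mk_left a b⟩
        symm := by
          refine ⟨?_⟩
          rintro a b ⟨e, he, hab⟩
          exact ⟨e, he, by rw [hab, Sym2.eq_swap]⟩ }
    refine ⟨H, ?_, ?_⟩
    · rintro a ⟨e, he, ha⟩
      obtain ⟨b, hb⟩ := Sym2.mem_iff_exists.mp ha
      refine ⟨b, ⟨e, he, hb⟩, ?_⟩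
      rintro c ⟨f, hf, hc⟩
      have hef := hM e he f hf a ha (by rw [hc]; exact Sym2.mem_mk_left a c)
      rw [← hef, hb] at hc
      exact (Sym2.congr_right.mp hc).symm
    · refine hk.trans ?_
      rw [← Finset.card_map (Function.Embedding.subtype _), ← Set.ncard_coe_finset]
      refine Set.ncard_le_ncard ?_ (Set.toFinite _)
      intro e he
      simp only [Finset.coe_map, Function.Embedding.subtype_apply, Set.mem_image,
        Finset.mem_coe] at he
      obtain ⟨e, he, rfl⟩ := he
      obtain ⟨⟨a, b⟩, hd⟩ := e
      exact ⟨_, he, rfl⟩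

/-- The number of pairs of a matching that meet a vertex set is at most the size of that set. -/
theorem IsPairMatching.card_le_of_forall_exists_mem {M : Finset (VertexPair n)}
    (hM : IsPairMatching M) {S : Finset (Fin n)}
    (h : ∀ e ∈ M, ∃ a ∈ S, a ∈ (e : Sym2 (Fin n))) : M.card ≤ S.card := by
  rcases M.eq_empty_or_nonempty with rfl | ⟨e₀, he₀⟩
  · simp
  have : Nonempty (Fin n) := ⟨(h e₀ he₀).choose⟩
  choose! f hfS hfe using h
  refine Finset.card_le_card_of_injOn f hfS fun e he e' he' hee => ?_
  exact hM e he e' he' (f e) (hfe e he) (hee ▸ hfe e' he')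

/-- The vertices covered by a set of vertex pairs. -/
def coveredVerts (M : Finset (VertexPair n)) : Finset (Fin n) :=
  Finset.univ.filter fun a => ∃ e ∈ M, a ∈ (e : Sym2 (Fin n))

theorem card_coveredVerts_le (M : Finset (VertexPair n)) : (coveredVerts M).card ≤ 2 * M.card := by
  classical
  have h : coveredVerts M ⊆ M.biUnion fun e => (e : Sym2 (Fin n)).toFinset := by
    intro a ha
    obtain ⟨e, he, hae⟩ := (Finset.mem_filter.mp ha).2
    exact Finset.mem_biUnion.mpr ⟨e, he, Sym2.mem_toFinset.mpr hae⟩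
  refine (Finset.card_le_card h).trans ?_
  rw [mul_comm]
  exact Finset.card_biUnion_le_card_mul _ _ _ fun e _ => by
    rw [Sym2.card_toFinset]; split_ifs <;> omega

end Matchings

/-! ### Decision trees with weighted answers. -/

section Knowledge

variable {n : ℕ} {β : Type} {F : SimpleGraph (Fin n) → β}

/-- The graphs that contain the pairs in `E₁` and avoid those in `E₀`. -/
def consistentGraphs (E₁ E₀ : Finset (VertexPair n)) : Set (SimpleGraph (Fin n)) :=
  {G | (∀ e ∈ E₁, adjBit G e = true) ∧ ∀ e ∈ E₀, adjBit G e = false}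

/-- The parameter `a` trades the price of the two answers: a small `a` makes the expected non-edges
cheap and the rare edges expensive. -/
theorem DualAdversary.query_consistent {E₁ E₀ : Finset (VertexPair n)} (e : VertexPair n)
    {a W W₀ W₁ : ℝ} (ha : 0 < a)
    (h₀ : DualAdversary F (consistentGraphs E₁ (insert e E₀)) W₀)
    (h₁ : DualAdversary F (consistentGraphs (insert e E₁) E₀) W₁)
    (hW₀ : a / 2 + W₀ ≤ W) (hW₁ : 1 / (2 * a) + W₁ ≤ W) :
    DualAdversary F (consistentGraphs E₁ E₀) W := by
  refine DualAdversary.query e (W₀ := W₀) (W₁ := W₁) (c₀ := √(a / 2)) (c₁ := √(1 / (2 * a)))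
    ?_ ?_ ?_ ?_ ?_
  · convert h₀ using 1
    ext G
    simp only [consistentGraphs, Set.mem_ofPred_eq, Finset.forall_mem_insert]
    tauto
  · convert h₁ using 1
    ext G
    simp only [consistentGraphs, Set.mem_ofPred_eq, Finset.forall_mem_insert]
    tauto
  · rw [← Real.sqrt_mul (by positivity), show a / 2 * (1 / (2 * a)) = (1 / 2) ^ 2 by
      field_simp,
      Real.sqrt_sq (by norm_num)]
    norm_num
  · rwa [Real.sq_sqrt (by positivity)]
  · rwa [Real.sq_sqrt (by positivity)]

/-- With `a = 1` either answer costs `1 / 2`. Re-querying a known pair is harmless, since a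
contradictory branch contains no graph. -/
theorem DualAdversary.query_all (D : Finset (VertexPair n)) {W : ℝ} :
    ∀ {E₁ E₀ : Finset (VertexPair n)},
      (∀ E₁' E₀', E₁ ⊆ E₁' → E₀ ⊆ E₀' → D ⊆ E₁' ∪ E₀' →
        DualAdversary F (consistentGraphs E₁' E₀') W) →
      DualAdversary F (consistentGraphs E₁ E₀) (W + D.card / 2) := by
  induction D using Finset.induction_on with
  | empty =>
    intro E₁ E₀ h
    simpa using h E₁ E₀ subset_rfl subset_rfl (by simp)
  | insert e D he ih =>
    intro E₁ E₀ h
    rw [Finset.card_insert_of_notMem he]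
    push_cast
    refine DualAdversary.query_consistent e one_pos
      (ih fun E₁' E₀' h₁ h₀ hD => h E₁' E₀' h₁ ((Finset.subset_insert _ _).trans h₀) ?_)
      (ih fun E₁' E₀' h₁ h₀ hD => h E₁' E₀' ((Finset.subset_insert _ _).trans h₁) h₀ ?_) ?_ ?_
    · exact Finset.insert_subset
        (Finset.mem_union_right _ (h₀ (Finset.mem_insert_self _ _))) hD
    · exact Finset.insert_subset
        (Finset.mem_union_left _ (h₁ (Finset.mem_insert_self _ _))) hD
    · linarith
    · linarith

end Knowledge

/-! ### Hall deficiency of the vertex cover. -/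

section Augmentation

variable {n : ℕ}

open Classical in
/-- The vertices of `I` that pairs in `E` join to a vertex of `X`. -/
noncomputable def nbrsIn (E : Finset (VertexPair n)) (I X : Finset (Fin n)) : Finset (Fin n) :=
  I.filter fun i => ∃ e ∈ E, ∃ x ∈ X, (e : Sym2 (Fin n)) = s(x, i)

theorem mem_nbrsIn {E : Finset (VertexPair n)} {I X : Finset (Fin n)} {i : Fin n} :
    i ∈ nbrsIn E I X ↔ i ∈ I ∧ ∃ e ∈ E, ∃ x ∈ X, (e : Sym2 (Fin n)) = s(x, i) := by
  simp [nbrsIn]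

theorem nbrsIn_mono {E E' : Finset (VertexPair n)} {I I' X X' : Finset (Fin n)} (hE : E ⊆ E')
    (hI : I ⊆ I') (hX : X ⊆ X') : nbrsIn E I X ⊆ nbrsIn E' I' X' := by
  intro i hi
  rw [mem_nbrsIn] at hi ⊢
  obtain ⟨h, e, he, x, hx, hex⟩ := hi
  exact ⟨hI h, e, hE he, x, hX hx, hex⟩

theorem nbrsIn_union (E : Finset (VertexPair n)) (I X Y : Finset (Fin n)) :
    nbrsIn E I (X ∪ Y) = nbrsIn E I X ∪ nbrsIn E I Y := by
  ext i
  simp only [Finset.mem_union, mem_nbrsIn]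
  constructor
  · rintro ⟨h, e, he, x, hx | hx, hex⟩
    · exact .inl ⟨h, e, he, x, hx, hex⟩
    · exact .inr ⟨h, e, he, x, hx, hex⟩
  · rintro (⟨h, e, he, x, hx, hex⟩ | ⟨h, e, he, x, hx, hex⟩)
    · exact ⟨h, e, he, x, .inl hx, hex⟩
    · exact ⟨h, e, he, x, .inr hx, hex⟩

/-- Let every pair outside `S` be a known non-edge, every pair inside `S ∪ I` be known, and every
pair joining `R ⊆ S` to a vertex outside `S ∪ I` be a known non-edge. If the deficiency
`|X| - |N(X)|` is maximal at `R`, then the known edges contain a matching as large as any. -/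
theorem exists_known_matching {E₁ E₀ : Finset (VertexPair n)} {S I R : Finset (Fin n)} {d : ℕ}
    (hSI : Disjoint S I) (hRS : R ⊆ S)
    (hout : ∀ e : VertexPair n, (∀ a ∈ (e : Sym2 (Fin n)), a ∉ S) → e ∈ E₀)
    (hin : ∀ e : VertexPair n, (∀ a ∈ (e : Sym2 (Fin n)), a ∈ S ∪ I) → e ∈ E₁ ∪ E₀)
    (hdef : ∀ X ⊆ S, X.card ≤ (nbrsIn E₁ I X).card + d)
    (hR : R.card = (nbrsIn E₁ I R).card + d)
    (hend : ∀ e : VertexPair n, ∀ r ∈ R, ∀ i, i ∉ S ∪ I → (e : Sym2 (Fin n)) = s(r, i) → e ∈ E₀)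
    {G : SimpleGraph (Fin n)} (hG : G ∈ consistentGraphs E₁ E₀) {M : Finset (VertexPair n)}
    (hM : IsPairMatching M) (hMG : ∀ e ∈ M, adjBit G e = true) :
    ∃ M' ⊆ E₁, IsPairMatching M' ∧ M.card ≤ M'.card := by
  classical
  have hIS : ∀ {a}, a ∈ I → a ∉ S := fun h h' => Finset.disjoint_left.mp hSI h' h
  let N : Finset (Fin n) → Finset (Fin n) := nbrsIn E₁ I
  -- Hall's theorem matches `S \ R` into `I` outside `N R`: since `R` has the largest deficiency,
  -- adding `X'` to `R` must add at least `|X'|` new neighbours.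
  have hall := (Finset.all_card_le_biUnion_card_iff_exists_injective
    (fun s : {x // x ∈ S \ R} => N {(s : Fin n)} \ N R)).mp (by
      intro X
      let X' : Finset (Fin n) := X.map (Function.Embedding.subtype _)
      have hX' : X' ⊆ S \ R := by
        intro x hx
        obtain ⟨y, _, rfl⟩ := Finset.mem_map.mp hx
        exact y.2
      have h1 := hdef (R ∪ X') (Finset.union_subset hRS (hX'.trans Finset.sdiff_subset))
      have hdj : Disjoint R X' :=
        Finset.disjoint_left.mpr fun x hx hx' => (Finset.mem_sdiff.mp (hX' hx')).2 hx
      rw [Finset.card_union_of_disjoint hdj, nbrsIn_union, hR, Finset.card_map] at h1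
      have h2 : (nbrsIn E₁ I R ∪ nbrsIn E₁ I X').card = (N R).card + (N X' \ N R).card := by
        rw [← Finset.card_union_of_disjoint Finset.disjoint_sdiff, Finset.union_sdiff_self_eq_union]
      have h3 : N X' \ N R ⊆ X.biUnion fun s => N {(s : Fin n)} \ N R := by
        intro i hi
        obtain ⟨hi, hiR⟩ := Finset.mem_sdiff.mp hi
        obtain ⟨hiI, e, he, x, hx, hex⟩ := mem_nbrsIn.mp hi
        obtain ⟨y, hy, rfl⟩ := Finset.mem_map.mp hx
        exact Finset.mem_biUnion.mpr ⟨y, hy, Finset.mem_sdiff.mpr ⟨mem_nbrsIn.mpr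
          ⟨hiI, e, he, y, Finset.mem_singleton_self _, hex⟩, hiR⟩⟩
      have h4 := Finset.card_le_card h3
      simp only [N] at h2 h4 ⊢
      omega)
  obtain ⟨f, hfinj, hf⟩ := hall
  have hfI : ∀ s : {x // x ∈ S \ R}, f s ∈ I := fun s =>
    (mem_nbrsIn.mp (Finset.mem_sdiff.mp (hf s)).1).1
  have hfR : ∀ s, f s ∉ N R := fun s => (Finset.mem_sdiff.mp (hf s)).2
  have hg : ∀ s : {x // x ∈ S \ R}, ∃ e : VertexPair n, e ∈ E₁ ∧
      (e : Sym2 (Fin n)) = s((s : Fin n), f s) := by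
    intro s
    obtain ⟨_, e, he, x, hx, hex⟩ := mem_nbrsIn.mp (Finset.mem_sdiff.mp (hf s)).1
    rw [Finset.mem_singleton] at hx
    exact ⟨e, he, hx ▸ hex⟩
  choose g hgE hgs using hg
  have hsS : ∀ s : {x // x ∈ S \ R}, (s : Fin n) ∈ S := fun s => (Finset.mem_sdiff.mp s.2).1
  -- The edges of `M` avoiding `S \ R` meet `R`, hence are known, and touch `I` only inside `N R`.
  -- The remaining ones number at most `|S \ R|` and are replaced by the Hall matching.
  let M₁ : Finset (VertexPair n) := M.filter fun e => ∀ a ∈ (e : Sym2 (Fin n)), a ∉ S \ R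
  have hM₁ : ∀ e ∈ M₁, e ∈ E₁ ∧ ∃ r ∈ R, ∃ b ∈ S ∪ I, (e : Sym2 (Fin n)) = s(r, b) := by
    intro e he
    obtain ⟨heM, heS⟩ := Finset.mem_filter.mp he
    have he0 : e ∉ E₀ := fun h => by
      have := hG.2 e h
      rw [hMG e heM] at this
      cases this
    have hr : ∃ r ∈ R, r ∈ (e : Sym2 (Fin n)) := by
      by_contra! hcon
      refine he0 (hout e fun a ha haS => ?_)
      exact heS a ha (Finset.mem_sdiff.mpr ⟨haS, fun haR => hcon a haR ha⟩)
    obtain ⟨r, hr, hre⟩ := hr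
    obtain ⟨b, hb⟩ := Sym2.mem_iff_exists.mp hre
    have hbSI : b ∈ S ∪ I := by
      by_contra hbSI
      exact he0 (hend e r hr b hbSI hb)
    refine ⟨?_, r, hr, b, hbSI, hb⟩
    refine (Finset.mem_union.mp (hin e ?_)).resolve_right he0
    intro a ha
    rw [hb, Sym2.mem_iff] at ha
    rcases ha with rfl | rfl
    · exact Finset.mem_union_left _ (hRS hr)
    · exact hbSI
  have hdisj : ∀ e ∈ M₁, ∀ s, ∀ a, a ∈ (e : Sym2 (Fin n)) → a ∉ (g s : Sym2 (Fin n)) := by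
    intro e he s a hae hag
    rw [hgs, Sym2.mem_iff] at hag
    rcases hag with rfl | rfl
    · exact (Finset.mem_filter.mp he).2 _ hae s.2
    · obtain ⟨heE, r, hr, b, hb, hrb⟩ := hM₁ e he
      rw [hrb, Sym2.mem_iff] at hae
      rcases hae with h | h
      · exact hIS (hfI s) (h ▸ hRS hr)
      · exact hfR s (mem_nbrsIn.mpr ⟨hfI s, e, heE, r, hr, h ▸ hrb⟩)
  have hginj : ∀ s s' a, a ∈ (g s : Sym2 (Fin n)) → a ∈ (g s' : Sym2 (Fin n)) → s = s' := by
    intro s s' a h h'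
    rw [hgs, Sym2.mem_iff] at h h'
    rcases h with h | h <;> rcases h' with h' | h'
    · exact Subtype.ext (h.symm.trans h')
    · exact absurd (hsS s) (hIS (h ▸ h' ▸ hfI s'))
    · exact absurd (hsS s') (hIS (h' ▸ h ▸ hfI s))
    · exact hfinj (h.symm.trans h')
  have hgmem : ∀ s : {x // x ∈ S \ R}, (s : Fin n) ∈ (g s : Sym2 (Fin n)) := fun s => by
    rw [hgs]; exact Sym2.mem_mk_left _ _
  refine ⟨M₁ ∪ Finset.univ.image g, ?_, ?_, ?_⟩
  · refine Finset.union_subset (fun e he => (hM₁ e he).1) ?_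
    intro e he
    obtain ⟨s, _, rfl⟩ := Finset.mem_image.mp he
    exact hgE s
  · intro e he e' he' a ha ha'
    rw [Finset.mem_union, Finset.mem_image] at he he'
    rcases he with he | ⟨s, _, rfl⟩
    · rcases he' with he' | ⟨s', _, rfl⟩
      · exact hM e (Finset.mem_filter.mp he).1 e' (Finset.mem_filter.mp he').1 a ha ha'
      · exact absurd ha' (hdisj e he s' a ha)
    · rcases he' with he' | ⟨s', _, rfl⟩
      · exact absurd ha (hdisj e' he' s a ha')
      · rw [hginj s s' a ha ha']
  · have hdj : Disjoint M₁ (Finset.univ.image g) := by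
      rw [Finset.disjoint_left]
      intro e he he'
      obtain ⟨s, _, rfl⟩ := Finset.mem_image.mp he'
      exact hdisj _ he s s (hgmem s) (hgmem s)
    rw [Finset.card_union_of_disjoint hdj, Finset.card_image_of_injective _
      (show Function.Injective g from fun s s' h => hginj s s' s (hgmem s) (h ▸ hgmem s)),
      Finset.card_univ, Fintype.card_coe,
      ← Finset.card_filter_add_card_filter_not (s := M)
        (fun e => ∀ a ∈ (e : Sym2 (Fin n)), a ∉ S \ R)]
    refine Nat.add_le_add_left ?_ _
    refine (hM.mono (Finset.filter_subset _ _)).card_le_of_forall_exists_mem ?_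
    intro e he
    have := (Finset.mem_filter.mp he).2
    push Not at this
    obtain ⟨a, ha, haS⟩ := this
    exact ⟨a, haS, ha⟩

/-- Among the sets of maximal deficiency `|X| - |N(X)| = d`, if there are any, there is one that is
contained in all of them. -/
theorem exists_least_tight {E : Finset (VertexPair n)} {S I : Finset (Fin n)} {d : ℕ}
    (hdef : ∀ X ⊆ S, X.card ≤ (nbrsIn E I X).card + d)
    (hex : ∃ X ⊆ S, X.card = (nbrsIn E I X).card + d) :
    ∃ R ⊆ S, R.card = (nbrsIn E I R).card + d ∧
      ∀ X ⊆ S, X.card = (nbrsIn E I X).card + d → R ⊆ X := by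
  classical
  let T := S.powerset.filter fun X => X.card = (nbrsIn E I X).card + d
  have hT : T.Nonempty := by
    obtain ⟨X, hX, h⟩ := hex
    exact ⟨X, Finset.mem_filter.mpr ⟨Finset.mem_powerset.mpr hX, h⟩⟩
  obtain ⟨R, hR, hmin⟩ := T.exists_min_image Finset.card hT
  obtain ⟨hRS, hRd⟩ := Finset.mem_filter.mp hR
  rw [Finset.mem_powerset] at hRS
  refine ⟨R, hRS, hRd, fun X hX hXd => ?_⟩
  -- Deficiency is supermodular, because `|N|` is submodular, so its maximisers are closed under
  -- intersection; a maximiser of least size lies in all others.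
  have h1 := hdef (R ∪ X) (Finset.union_subset hRS hX)
  have h2 := hdef (R ∩ X) (Finset.inter_subset_left.trans hRS)
  have h3 := Finset.card_union_add_card_inter R X
  have h4 := Finset.card_union_add_card_inter (nbrsIn E I R) (nbrsIn E I X)
  have h5 : (nbrsIn E I (R ∩ X)).card ≤ (nbrsIn E I R ∩ nbrsIn E I X).card :=
    Finset.card_le_card (Finset.subset_inter
      (nbrsIn_mono subset_rfl subset_rfl Finset.inter_subset_left)
      (nbrsIn_mono subset_rfl subset_rfl Finset.inter_subset_right))
  rw [nbrsIn_union] at h1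
  have h6 : R ∩ X ∈ T := Finset.mem_filter.mpr
    ⟨Finset.mem_powerset.mpr (Finset.inter_subset_left.trans hRS), by omega⟩
  exact Finset.inter_eq_left.mp
    (Finset.eq_of_subset_of_card_le Finset.inter_subset_left (hmin _ h6))

end Augmentation

/-! ### The decision tree for `k`-matching and its cost. -/

section DecisionTree

variable {n : ℕ}

theorem kMatching_eq_true {k : ℕ} {G : SimpleGraph (Fin n)} {M : Finset (VertexPair n)}
    (hM : IsPairMatching M) (hMG : ∀ e ∈ M, adjBit G e = true) (hk : k ≤ M.card) :
    kMatching n k G = true := by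
  simp only [kMatching, decide_eq_true_eq]
  exact hasMatchingOfSize_iff.mpr ⟨M, hMG, hM, hk⟩

theorem card_compl_insert_add_one {E : Finset (VertexPair n)} {e : VertexPair n} (he : e ∉ E) :
    (insert e E)ᶜ.card + 1 = Eᶜ.card := by
  rw [Finset.compl_insert, Finset.card_erase_add_one (Finset.mem_compl.mpr he)]

/-- The cost of deciding `k`-matching once a vertex cover `S` is known, where the graph inside
`S ∪ I` is known and `d` bounds the number of vertices that still have to be added to `I`. -/
theorem dualAdversary_of_cover (k : ℕ) {α : ℝ} (hα : 0 < α) (S : Finset (Fin n)) :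
    ∀ (m d : ℕ) (I : Finset (Fin n)) (E₁ E₀ : Finset (VertexPair n)), E₀ᶜ.card + d < m →
      Disjoint S I →
      (∀ e : VertexPair n, (∀ a ∈ (e : Sym2 (Fin n)), a ∉ S) → e ∈ E₀) →
      (∀ e : VertexPair n, (∀ a ∈ (e : Sym2 (Fin n)), a ∈ S ∪ I) → e ∈ E₁ ∪ E₀) →
      (∀ X ⊆ S, X.card ≤ (nbrsIn E₁ I X).card + d) →
      DualAdversary (kMatching n k) (consistentGraphs E₁ E₀)
        (α / 2 * E₀ᶜ.card + d * (1 / (2 * α) + S.card / 2)) := by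
  classical
  intro m
  induction m with
  | zero => intro d I E₁ E₀ hm; omega
  | succ m ih =>
    intro d I E₁ E₀ hm hSI hout hin hdef
    have hempty : nbrsIn E₁ I ∅ = ∅ := by
      ext i; simp [mem_nbrsIn]
    have hpos : 0 ≤ 1 / (2 * α) + (S.card : ℝ) / 2 := by positivity
    by_cases hex : ∃ X ⊆ S, X.card = (nbrsIn E₁ I X).card + d
    swap
    -- Here `d` exceeds the true maximal deficiency, and can be lowered for free; `d = 0` is
    -- impossible since `∅` would be tight.
    · push Not at hex
      obtain ⟨d, rfl⟩ : ∃ d', d = d' + 1 := by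
        refine Nat.exists_eq_succ_of_ne_zero fun hd => hex ∅ (Finset.empty_subset _) ?_
        simp [hempty, hd]
      refine (ih d I E₁ E₀ (by omega) hSI hout hin fun X hX => ?_).mono ?_
      · have := hdef X hX
        have := hex X hX
        omega
      · push_cast
        linarith
    obtain ⟨R, hRS, hR, hleast⟩ := exists_least_tight hdef hex
    by_cases hend : ∀ e : VertexPair n, ∀ r ∈ R, ∀ i, i ∉ S ∪ I →
        (e : Sym2 (Fin n)) = s(r, i) → e ∈ E₀
    · by_cases hk : ∃ M ⊆ E₁, IsPairMatching M ∧ k ≤ M.card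
      · obtain ⟨M, hME, hM, hk⟩ := hk
        exact DualAdversary.of_const true
          (fun G hG => kMatching_eq_true hM (fun e he => hG.1 e (hME he)) hk) (by positivity)
      · refine DualAdversary.of_const false (fun G hG => ?_) (by positivity)
        simp only [kMatching, decide_eq_false_iff_not]
        intro h
        obtain ⟨M, hMG, hM, hkM⟩ := hasMatchingOfSize_iff.mp h
        obtain ⟨M', hM', hm', hc⟩ :=
          exists_known_matching hSI hRS hout hin hdef hR hend hG hM hMG
        exact hk ⟨M', hM', hm', hkM.trans hc⟩
    push Not at hend
    obtain ⟨e, r, hr, i, hi, hri, he⟩ := hend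
    rw [Finset.mem_union, not_or] at hi
    -- If `d = 0`, then `∅` is tight, so the least tight set `R` is empty and has no vertex `r`.
    obtain ⟨d, rfl⟩ : ∃ d', d = d' + 1 := by
      refine Nat.exists_eq_succ_of_ne_zero fun hd => ?_
      have := hleast ∅ (Finset.empty_subset _) (by simp [hempty, hd])
      exact Finset.notMem_empty r (this hr)
    let D : Finset (VertexPair n) := Finset.univ.filter fun f =>
      i ∈ (f : Sym2 (Fin n)) ∧ ∃ x ∈ S, x ∈ (f : Sym2 (Fin n))
    have hD : D.card ≤ S.card := by
      rw [← Finset.card_map (Function.Embedding.subtype _)]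
      refine (Finset.card_le_card (t := S.image fun x => s(x, i)) ?_).trans Finset.card_image_le
      intro f hf
      obtain ⟨f, hfD, rfl⟩ := Finset.mem_map.mp hf
      obtain ⟨hif, x, hx, hxf⟩ := (Finset.mem_filter.mp hfD).2
      refine Finset.mem_image.mpr ⟨x, hx, ?_⟩
      exact ((Sym2.mem_and_mem_iff (show x ≠ i from fun h => hi.1 (h ▸ hx))).mp ⟨hxf, hif⟩).symm
    have hcard := card_compl_insert_add_one he
    -- A non-edge is paid by the drop of `E₀ᶜ.card`; an edge, together with querying all pairs
    -- between `i` and `S`, is paid by the drop of `d`.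
    refine DualAdversary.query_consistent e hα
      (ih (d + 1) I E₁ (insert e E₀) (by omega) hSI
        (fun f hf => Finset.mem_insert_of_mem (hout f hf)) (fun f hf => ?_) hdef)
      (DualAdversary.query_all D (W := α / 2 * E₀ᶜ.card + d * (1 / (2 * α) + S.card / 2))
        fun E₁' E₀' h₁ h₀ hDE => ?_) ?_ ?_
    · exact Finset.union_subset_union_right (Finset.subset_insert _ _) (hin f hf)
    · have hcard' : E₀'ᶜ.card ≤ E₀ᶜ.card :=
        Finset.card_le_card (Finset.compl_subset_compl.mpr h₀)
      have hE₁ : E₁ ⊆ E₁' := (Finset.subset_insert _ _).trans h₁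
      refine (ih d (insert i I) E₁' E₀' (by omega) ?_ (fun f hf => h₀ (hout f hf)) ?_ ?_).mono ?_
      · exact Finset.disjoint_insert_right.mpr ⟨hi.1, hSI⟩
      · intro f hf
        by_cases hfi : i ∈ (f : Sym2 (Fin n))
        · by_cases hfS : ∃ x ∈ S, x ∈ (f : Sym2 (Fin n))
          · exact hDE (Finset.mem_filter.mpr ⟨Finset.mem_univ _, hfi, hfS⟩)
          · push Not at hfS
            exact Finset.mem_union_right _ (h₀ (hout f fun a ha haS => hfS a haS ha))
        · refine Finset.union_subset_union hE₁ h₀ (hin f fun a ha => ?_)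
          have := hf a ha
          rw [Finset.mem_union, Finset.mem_insert] at this
          rcases this with h | rfl | h
          · exact Finset.mem_union_left _ h
          · exact absurd ha hfi
          · exact Finset.mem_union_right _ h
      · intro X hX
        have hsub : nbrsIn E₁ I X ⊆ nbrsIn E₁' (insert i I) X :=
          nbrsIn_mono hE₁ (Finset.subset_insert _ _) subset_rfl
        have hle := hdef X hX
        -- A tight `X` contains `R`, hence `r`, and gains the neighbour `i`; a set that is not tight
        -- has slack already.
        by_cases ht : X.card = (nbrsIn E₁ I X).card + (d + 1)
        · have hiX : i ∈ nbrsIn E₁' (insert i I) X := mem_nbrsIn.mpr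
            ⟨Finset.mem_insert_self _ _, e, h₁ (Finset.mem_insert_self _ _), r,
              hleast X hX ht hr, hri⟩
          have hiX' : i ∉ nbrsIn E₁ I X := fun h => hi.2 (mem_nbrsIn.mp h).1
          have := Finset.card_le_card (Finset.insert_subset hiX hsub)
          rw [Finset.card_insert_of_notMem hiX'] at this
          omega
        · have := Finset.card_le_card hsub
          omega
      · gcongr
    · rw [← hcard]
      push_cast
      linarith
    · have : (D.card : ℝ) ≤ S.card := by exact_mod_cast hD
      push_cast
      linarith

/-- The cost of deciding `k`-matching by extending a known matching `M` to a maximal one. -/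
theorem dualAdversary_of_matching (k : ℕ) {α : ℝ} (hα : 0 < α) :
    ∀ (m : ℕ) (M E₀ : Finset (VertexPair n)), E₀ᶜ.card + (k - M.card) < m →
      IsPairMatching M → M.card ≤ k →
      DualAdversary (kMatching n k) (consistentGraphs M E₀)
        (α / 2 * E₀ᶜ.card + ((k : ℝ) - M.card) / (2 * α) + k / α + 4 * k ^ 2) := by
  classical
  intro m
  induction m with
  | zero => intro M E₀ hm; omega
  | succ m ih =>
    intro M E₀ hm hM hMk
    have hMk' : (M.card : ℝ) ≤ k := by exact_mod_cast hMk
    have hpos : 0 ≤ ((k : ℝ) - M.card) / (2 * α) := div_nonneg (by linarith) (by positivity)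
    rcases hMk.eq_or_lt with hk | hk
    · exact DualAdversary.of_const true (fun G hG => kMatching_eq_true hM hG.1 hk.ge)
        (by positivity)
    by_cases hex : ∃ e : VertexPair n, e ∉ E₀ ∧
        ∀ a ∈ (e : Sym2 (Fin n)), ∀ f ∈ M, a ∉ (f : Sym2 (Fin n))
    · obtain ⟨e, he, heM⟩ := hex
      have heM' : e ∉ M := by
        intro h
        obtain ⟨⟨a, b⟩, hd⟩ := e
        exact heM a (Sym2.mem_mk_left a b) _ h (Sym2.mem_mk_left a b)
      have hcard := card_compl_insert_add_one he
      have hcard' := Finset.card_insert_of_notMem heM'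
      refine DualAdversary.query_consistent e hα (ih M (insert e E₀) (by omega) hM hMk)
        (ih (insert e M) E₀ (by omega) (hM.insert heM) (by omega)) ?_ ?_
      · rw [← hcard]
        push_cast
        linarith
      · rw [hcard']
        push_cast
        have : ((k : ℝ) - (M.card + 1)) / (2 * α) = (k - M.card) / (2 * α) - 1 / (2 * α) := by
          rw [← sub_div]; ring_nf
        linarith
    -- The matching is maximal: every pair avoiding its vertices is a known non-edge. Exploring the
    -- inside of `S` costs `2 * k ^ 2`, and the cover phase starts with `I = ∅` and `d = |S| ≤ 2 *
    -- k`.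
    · push Not at hex
      let S := coveredVerts M
      have hS : S.card ≤ 2 * k := (card_coveredVerts_le M).trans (by omega)
      have hS' : (S.card : ℝ) ≤ 2 * k := by exact_mod_cast hS
      have hout : ∀ e : VertexPair n, (∀ a ∈ (e : Sym2 (Fin n)), a ∉ S) → e ∈ E₀ := by
        intro e he
        by_contra h
        obtain ⟨a, ha, f, hf, haf⟩ := hex e h
        exact he a ha (Finset.mem_filter.mpr ⟨Finset.mem_univ _, f, hf, haf⟩)
      let D : Finset (VertexPair n) := Finset.univ.filter fun e =>
        ∀ a ∈ (e : Sym2 (Fin n)), a ∈ S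
      have hD : D.card ≤ S.card * S.card := by
        rw [← Finset.card_map (Function.Embedding.subtype _), ← Finset.card_product]
        refine (Finset.card_le_card (t := (S ×ˢ S).image fun x => s(x.1, x.2)) ?_).trans
          Finset.card_image_le
        intro f hf
        obtain ⟨⟨⟨a, b⟩, hd⟩, hfD, rfl⟩ := Finset.mem_map.mp hf
        have hab := (Finset.mem_filter.mp hfD).2
        exact Finset.mem_image.mpr ⟨(a, b), Finset.mem_product.mpr
          ⟨hab a (Sym2.mem_mk_left a b), hab b (Sym2.mem_mk_right a b)⟩, rfl⟩
      have hD' : (D.card : ℝ) ≤ (2 * k) * (2 * k) := by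
        calc (D.card : ℝ) ≤ S.card * S.card := by exact_mod_cast hD
          _ ≤ (2 * k) * (2 * k) := by gcongr
      refine (DualAdversary.query_all D
        (W := α / 2 * E₀ᶜ.card + 2 * k * (1 / (2 * α) + 2 * k / 2))
        fun E₁' E₀' h₁ h₀ hDE => ?_).mono ?_
      · refine (dualAdversary_of_cover k hα S _ S.card ∅ E₁' E₀' (Nat.lt_succ_self _) (by simp)
          (fun e he => h₀ (hout e he)) (fun e he => hDE ?_) (fun X hX => ?_)).mono ?_
        · exact Finset.mem_filter.mpr ⟨Finset.mem_univ _, by simpa using he⟩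
        · exact (Finset.card_le_card hX).trans (Nat.le_add_left _ _)
        · have hcard' : E₀'ᶜ.card ≤ E₀ᶜ.card :=
            Finset.card_le_card (Finset.compl_subset_compl.mpr h₀)
          gcongr
      · have h1 : 2 * (k : ℝ) * (1 / (2 * α) + 2 * k / 2) = k / α + 2 * k ^ 2 := by
          field_simp
        rw [h1]
        linarith

theorem card_vertexPair_le (n : ℕ) : Fintype.card (VertexPair n) ≤ n ^ 2 := by
  rw [Sym2.card_subtype_not_diag, Fintype.card_fin]
  exact Nat.choose_le_pow n 2

theorem dualAdversary_kMatching {k : ℕ} (hn : 0 < n) (hk : 0 < k) :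
    DualAdversary (kMatching n k) Set.univ (2 * (√k * n) + 4 * k ^ 2) := by
  have hn' : (0 : ℝ) < n := by exact_mod_cast hn
  have hk' : (0 : ℝ) < k := by exact_mod_cast hk
  have hs : 0 < √(k : ℝ) := Real.sqrt_pos.mpr hk'
  -- This `α` balances up to `n ^ 2` non-edges at `α / 2` against `O(k)` edges at `1 / (2 * α)`.
  have h := dualAdversary_of_matching (n := n) k (α := √k / n) (by positivity) _ ∅ ∅
    (Nat.lt_succ_self _) (by intro e he; simp at he) (Nat.zero_le _)
  have hu : consistentGraphs (∅ : Finset (VertexPair n)) ∅ = Set.univ := by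
    ext G; simp [consistentGraphs]
  rw [hu] at h
  refine h.mono ?_
  rw [Finset.compl_empty, Finset.card_univ, Finset.card_empty]
  have h1 : (Fintype.card (VertexPair n) : ℝ) ≤ n ^ 2 := by exact_mod_cast card_vertexPair_le n
  have h2 : √(k : ℝ) / n / 2 * Fintype.card (VertexPair n) ≤ √k * n / 2 := by
    calc √(k : ℝ) / n / 2 * Fintype.card (VertexPair n) ≤ √(k : ℝ) / n / 2 * n ^ 2 := by gcongr
      _ = √k * n / 2 := by field_simp
  have h3 : (k : ℝ) / (√k / n) = √k * n := by
    rw [div_div_eq_mul_div, div_eq_iff hs.ne']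
    nlinarith [Real.mul_self_sqrt hk'.le]
  have h4 : ((k : ℝ) - (0 : ℕ)) / (2 * (√k / n)) = √k * n / 2 := by
    rw [← h3, Nat.cast_zero, sub_zero]
    field_simp
  rw [h3, h4]
  linarith

end DecisionTree

/-! ### The adversary lower bound. -/

section Adversary

variable {n w : ℕ}

/-- The squared amplitude that `ψ` has at the query `e`. -/
noncomputable def queryMass (ψ : BasisLabel n w → ℂ) (e : VertexPair n) : ℝ :=
  ∑ x, if x.1 = e then ‖ψ x‖ ^ 2 else 0

theorem queryMass_nonneg (ψ : BasisLabel n w → ℂ) (e : VertexPair n) : 0 ≤ queryMass ψ e :=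
  Finset.sum_nonneg fun x _ => by split_ifs <;> positivity

theorem sum_queryMass (ψ : BasisLabel n w → ℂ) : ∑ e, queryMass ψ e = ∑ x, ‖ψ x‖ ^ 2 := by
  simp only [queryMass]
  rw [Finset.sum_comm]
  simp

theorem queryMass_applyOracle (G : SimpleGraph (Fin n)) (ψ : BasisLabel n w → ℂ)
    (e : VertexPair n) : queryMass (applyOracle G ψ) e = queryMass ψ e :=
  Equiv.sum_comp (oraclePerm G) fun x => if x.1 = e then ‖ψ x‖ ^ 2 else 0

theorem abs_re_star_mul_le (a b : ℂ) {r : ℝ} (hr : 0 < r) :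
    |(star a * b).re| ≤ (r * ‖a‖ ^ 2 + r⁻¹ * ‖b‖ ^ 2) / 2 := by
  have h1 : |(star a * b).re| ≤ ‖a‖ * ‖b‖ := by
    refine (Complex.abs_re_le_norm _).trans ?_
    rw [norm_mul, norm_star]
  have h2 : 0 ≤ r * (‖a‖ - r⁻¹ * ‖b‖) ^ 2 := by positivity
  have h3 : r * (‖a‖ - r⁻¹ * ‖b‖) ^ 2 = r * ‖a‖ ^ 2 + r⁻¹ * ‖b‖ ^ 2 - 2 * (‖a‖ * ‖b‖) := by
    field_simp
    ring
  linarith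

/-- One query to graphs that differ in the pair `e` only changes the inner product of two states by
at most their amplitudes at `e`. -/
theorem re_dotProduct_sub_applyOracle_le {G H : SimpleGraph (Fin n)} {e : VertexPair n}
    (hGH : ∀ f, f ≠ e → adjBit G f = adjBit H f) (ψ φ : BasisLabel n w → ℂ) {r : ℝ} (hr : 0 < r) :
    (star ψ ⬝ᵥ φ).re - (star (applyOracle G ψ) ⬝ᵥ applyOracle H φ).re ≤
      r * queryMass ψ e + r⁻¹ * queryMass φ e := by
  -- The oracle of `G` is a self-adjoint involution and can be moved to the other side; the product
  -- of both oracles is the identity away from `e`.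
  let φ' : BasisLabel n w → ℂ := applyOracle G (applyOracle H φ)
  have h1 : star (applyOracle G ψ) ⬝ᵥ applyOracle H φ = star ψ ⬝ᵥ φ' := by
    rw [dotProduct, ← Equiv.sum_comp (oraclePerm G)]
    refine Finset.sum_congr rfl fun x _ => ?_
    simp [φ', applyOracle, oraclePerm]
  have h2 : queryMass φ' e = queryMass φ e := by
    rw [queryMass_applyOracle, queryMass_applyOracle]
  have h3 : r * queryMass ψ e + r⁻¹ * queryMass φ e =
      (r * queryMass ψ e + r⁻¹ * queryMass φ e) / 2 +
        (r * queryMass ψ e + r⁻¹ * queryMass φ' e) / 2 := by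
    rw [h2]; ring
  rw [h1, h3]
  simp only [dotProduct, Complex.re_sum, queryMass, Finset.mul_sum, ← Finset.sum_add_distrib,
    ← Finset.sum_sub_distrib, Finset.sum_div]
  refine Finset.sum_le_sum fun x _ => ?_
  by_cases hx : x.1 = e
  · simp only [hx, if_true]
    have a1 := (abs_le.mp (abs_re_star_mul_le (ψ x) (φ x) hr)).2
    have a2 := (abs_le.mp (abs_re_star_mul_le (ψ x) (φ' x) hr)).1
    simp only [Pi.star_apply]
    linarith
  · have : φ' x = φ x := by
      simp [φ', applyOracle, hGH x.1 hx]
    simp [hx, this]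

namespace QuantumQueryAlgorithm

variable {β : Type} (A : QuantumQueryAlgorithm n β)

/-- Each outcome is wrong for at least one of the two inputs. A weighted AM-GM inequality, tilted
against the state for which the outcome is wrong, gives `1/3 + 3/4 + 5/12 - 2 * (5/12) * (2/3) =
17/18`. -/
theorem re_dotProduct_state_le {F : SimpleGraph (Fin n) → β} (hA : A.Computes F)
    {G H : SimpleGraph (Fin n)} (hGH : F G ≠ F H) :
    (star (A.state G A.queries) ⬝ᵥ A.state H A.queries).re ≤ 17 / 18 := by
  classical
  set ψ := A.state G A.queries with hψ
  set φ := A.state H A.queries with hφ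
  have hG := hA G
  have hH := hA H
  simp only [outputProb, ← hψ, ← hφ] at hG hH
  have h1 : (star ψ ⬝ᵥ φ).re ≤ ∑ x, (1 / 3 * ‖ψ x‖ ^ 2 + 3 / 4 * ‖φ x‖ ^ 2 +
      5 / 12 * (‖ψ x‖ ^ 2 - if A.output x = F G then ‖ψ x‖ ^ 2 else 0) -
      5 / 12 * if A.output x = F H then ‖φ x‖ ^ 2 else 0) := by
    rw [dotProduct, Complex.re_sum]
    refine Finset.sum_le_sum fun x _ => ?_
    have a1 := (abs_le.mp (abs_re_star_mul_le (ψ x) (φ x) (r := 3 / 2) (by norm_num))).2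
    have a2 := (abs_le.mp (abs_re_star_mul_le (ψ x) (φ x) (r := 2 / 3) (by norm_num))).2
    rw [Pi.star_apply]
    have p1 := sq_nonneg ‖ψ x‖
    have p2 := sq_nonneg ‖φ x‖
    generalize (star (ψ x) * φ x).re = t at a1 a2 ⊢
    norm_num at a1 a2
    by_cases c1 : A.output x = F G
    · have c2 : A.output x ≠ F H := fun h => hGH (c1.symm.trans h)
      simp only [c1, if_true, hGH, if_false]
      linarith
    · by_cases c2 : A.output x = F H
      · simp only [c2, if_true, hGH.symm, if_false]
        linarith
      · simp only [c1, c2, if_false]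
        linarith
  simp only [Finset.sum_add_distrib, Finset.sum_sub_distrib, ← Finset.mul_sum] at h1
  rw [hψ, hφ, A.sum_sq_state, A.sum_sq_state, ← hψ, ← hφ] at h1
  linarith

/-- The adversary bound for a relation `R` between the inputs `gr t` with `t ∈ X` and those with
`t ∈ Y`, where related inputs differ in one vertex pair `e r`, and different relatives of an input
differ from it in different vertex pairs. -/
theorem card_le_of_relation {F : SimpleGraph (Fin n) → β} (hA : A.Computes F) {κ τ : Type*}
    (gr : τ → SimpleGraph (Fin n)) (R : Finset κ) (X Y : Finset τ) (g h : κ → τ)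
    (e : κ → VertexPair n)
    (hdiff : ∀ r ∈ R, ∀ f, f ≠ e r → adjBit (gr (g r)) f = adjBit (gr (h r)) f)
    (hF : ∀ r ∈ R, F (gr (g r)) ≠ F (gr (h r)))
    (hX : ∀ r ∈ R, g r ∈ X) (hY : ∀ r ∈ R, h r ∈ Y)
    (hgi : Set.InjOn (fun r => (g r, e r)) R) (hhi : Set.InjOn (fun r => (h r, e r)) R)
    {c : ℝ} (hc : 0 < c) :
    (R.card : ℝ) / 18 ≤ A.queries * (c * X.card + c⁻¹ * Y.card) := by
  classical
  let Φ : ℕ → ℝ := fun t =>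
    ∑ r ∈ R, (star (A.state (gr (g r)) t) ⬝ᵥ A.state (gr (h r)) t).re
  -- Relations at one input use different pairs, so their query masses add up to at most the total
  -- mass `1`.
  have hmass : ∀ (Z : Finset τ) (p : κ → τ), (∀ r ∈ R, p r ∈ Z) →
      Set.InjOn (fun r => (p r, e r)) R → ∀ t,
      ∑ r ∈ R, queryMass (A.state (gr (p r)) t) (e r) ≤ Z.card := by
    intro Z p hp hinj t
    calc ∑ r ∈ R, queryMass (A.state (gr (p r)) t) (e r)
        = ∑ y ∈ R.image fun r => (p r, e r), queryMass (A.state (gr y.1) t) y.2 :=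
          (Finset.sum_image (f := fun y : τ × VertexPair n =>
            queryMass (A.state (gr y.1) t) y.2) hinj).symm
      _ ≤ ∑ y ∈ Z ×ˢ Finset.univ, queryMass (A.state (gr y.1) t) y.2 := by
          refine Finset.sum_le_sum_of_subset_of_nonneg ?_ fun y _ _ => queryMass_nonneg _ _
          intro y hy
          obtain ⟨r, hr, rfl⟩ := Finset.mem_image.mp hy
          exact Finset.mem_product.mpr ⟨hp r hr, Finset.mem_univ _⟩
      _ = Z.card := by
          rw [Finset.sum_product]
          simp [sum_queryMass, A.sum_sq_state]
  have hstep : ∀ t, Φ t - Φ (t + 1) ≤ c * X.card + c⁻¹ * Y.card := by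
    intro t
    have h1 : Φ t - Φ (t + 1) ≤ ∑ r ∈ R, (c * queryMass (A.state (gr (g r)) t) (e r) +
        c⁻¹ * queryMass (A.state (gr (h r)) t) (e r)) := by
      simp only [Φ]
      rw [← Finset.sum_sub_distrib]
      refine Finset.sum_le_sum fun r hr => ?_
      simp only [state, unitary_mulVec_dotProduct]
      exact re_dotProduct_sub_applyOracle_le (hdiff r hr) _ _ hc
    rw [Finset.sum_add_distrib, ← Finset.mul_sum, ← Finset.mul_sum] at h1
    have h2 := mul_le_mul_of_nonneg_left (hmass X g hX hgi t) hc.le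
    have h3 := mul_le_mul_of_nonneg_left (hmass Y h hY hhi t) (inv_pos.mpr hc).le
    linarith
  have htotal : ∀ t : ℕ, Φ 0 - Φ t ≤ t * (c * X.card + c⁻¹ * Y.card) := by
    intro t
    induction t with
    | zero => simp
    | succ t ih =>
      have := hstep t
      push_cast
      linarith
  have h0 : Φ 0 = R.card := by
    have : ∀ r ∈ R, (star (A.state (gr (g r)) 0) ⬝ᵥ A.state (gr (h r)) 0).re = 1 := by
      intro r _
      have h1 : A.state (gr (h r)) 0 = A.state (gr (g r)) 0 := rfl
      rw [h1, dotProduct_star_self_eq, A.sum_sq_state, Complex.ofReal_re]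
    simp only [Φ]
    rw [Finset.sum_congr rfl this]
    simp
  have hend : Φ A.queries ≤ R.card * (17 / 18) := by
    rw [← nsmul_eq_mul]
    exact Finset.sum_le_card_nsmul _ _ _ fun r hr => A.re_dotProduct_state_le hA (hF r hr)
  have := htotal A.queries
  linarith

end QuantumQueryAlgorithm

end Adversary

/-! ### Matchings of sizes `k - 1` and `k` as hard inputs. -/

section MatchingLowerBound

variable {n : ℕ}

/-- The graph whose edges are the pairs in `M`. -/
def graphOfPairs (M : Finset (VertexPair n)) : SimpleGraph (Fin n) :=
  SimpleGraph.fromEdgeSet {e | ∃ f ∈ M, (f : Sym2 (Fin n)) = e}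

theorem adjBit_graphOfPairs {M : Finset (VertexPair n)} {e : VertexPair n} :
    adjBit (graphOfPairs M) e = true ↔ e ∈ M := by
  rw [adjBit_eq_true, graphOfPairs, SimpleGraph.edgeSet_fromEdgeSet]
  constructor
  · rintro ⟨⟨f, hf, hfe⟩, _⟩
    rwa [← Subtype.ext hfe]
  · exact fun he => ⟨⟨e, he, rfl⟩, e.2⟩

theorem kMatching_graphOfPairs {M : Finset (VertexPair n)} (hM : IsPairMatching M) (k : ℕ) :
    kMatching n k (graphOfPairs M) = decide (k ≤ M.card) := by
  classical
  simp only [kMatching]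
  rw [decide_eq_decide, hasMatchingOfSize_iff]
  constructor
  · rintro ⟨M', hM', _, hk⟩
    exact hk.trans (Finset.card_le_card fun e he => adjBit_graphOfPairs.mp (hM' e he))
  · exact fun hk => ⟨M, fun e he => adjBit_graphOfPairs.mpr he, hM, hk⟩

open Classical in
/-- The matchings with `j` pairs. -/
noncomputable def pairMatchings (n j : ℕ) : Finset (Finset (VertexPair n)) :=
  Finset.univ.filter fun M => IsPairMatching M ∧ M.card = j

theorem mem_pairMatchings {j : ℕ} {M : Finset (VertexPair n)} :
    M ∈ pairMatchings n j ↔ IsPairMatching M ∧ M.card = j := by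
  simp [pairMatchings]

open Classical in
/-- The pairs that extend the matching `M`. -/
noncomputable def extensions (M : Finset (VertexPair n)) : Finset (VertexPair n) :=
  Finset.univ.filter fun e => e ∉ M ∧ IsPairMatching (insert e M)

/-- Any two of the at least `n - 2 * j` uncovered vertices give an extension. -/
theorem choose_le_card_extensions {j : ℕ} {M : Finset (VertexPair n)}
    (hM : M ∈ pairMatchings n j) : (n - 2 * j).choose 2 ≤ (extensions M).card := by
  classical
  obtain ⟨hM, hj⟩ := mem_pairMatchings.mp hM
  have h1 : n - 2 * j ≤ (coveredVerts M)ᶜ.card := by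
    rw [Finset.card_compl, Fintype.card_fin]
    have := card_coveredVerts_le M
    omega
  refine (Nat.choose_le_choose 2 h1).trans ?_
  rw [← Sym2.card_image_offDiag,
    ← Finset.card_map (Function.Embedding.subtype _) (s := extensions M)]
  refine Finset.card_le_card ?_
  intro e he
  obtain ⟨⟨a, b⟩, hab, rfl⟩ := Finset.mem_image.mp he
  obtain ⟨ha, hb, hne⟩ := Finset.mem_offDiag.mp hab
  have hd : ¬ (s(a, b)).IsDiag := by simpa using hne
  have hdis : ∀ x ∈ s(a, b), ∀ f ∈ M, x ∉ (f : Sym2 (Fin n)) := by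
    intro x hx f hf hxf
    have hxc : x ∈ coveredVerts M := Finset.mem_filter.mpr ⟨Finset.mem_univ _, f, hf, hxf⟩
    rcases Sym2.mem_iff.mp hx with rfl | rfl
    · exact Finset.mem_compl.mp ha hxc
    · exact Finset.mem_compl.mp hb hxc
  refine Finset.mem_map.mpr ⟨⟨s(a, b), hd⟩, Finset.mem_filter.mpr ⟨Finset.mem_univ _, ?_, ?_⟩, rfl⟩
  · exact fun h => hdis a (Sym2.mem_mk_left a b) _ h (Sym2.mem_mk_left a b)
  · exact hM.insert hdis

theorem pairMatchings_nonempty {j : ℕ} (hj : 2 * j ≤ n) : (pairMatchings n j).Nonempty := by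
  classical
  induction j with
  | zero => exact ⟨∅, mem_pairMatchings.mpr ⟨by intro e he; simp at he, rfl⟩⟩
  | succ j ih =>
    obtain ⟨M, hM⟩ := ih (by omega)
    have h1 : 0 < (extensions M).card :=
      (Nat.choose_pos (by omega)).trans_le (choose_le_card_extensions hM)
    obtain ⟨e, he⟩ := Finset.card_pos.mp h1
    obtain ⟨heM, hi⟩ := (Finset.mem_filter.mp he).2
    refine ⟨insert e M, mem_pairMatchings.mpr ⟨?_, ?_⟩⟩
    · convert hi
    · rw [Finset.card_insert_of_notMem heM, (mem_pairMatchings.mp hM).2]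

theorem sqrt_le_queries (A : QuantumQueryAlgorithm n Bool) {k : ℕ} (hk : 0 < k) (hkn : 2 * k ≤ n)
    (hA : A.Computes (kMatching n k)) :
    √(((n - 2 * (k - 1)).choose 2 : ℕ) * (k : ℝ)) ≤ 36 * A.queries := by
  classical
  obtain ⟨j, rfl⟩ : ∃ j, k = j + 1 := ⟨k - 1, by omega⟩
  rw [Nat.add_sub_cancel]
  set m := (n - 2 * j).choose 2 with hm
  have hm0 : 0 < m := Nat.choose_pos (by omega)
  let X := pairMatchings n j
  let Y := pairMatchings n (j + 1)
  let R : Finset (Finset (VertexPair n) × VertexPair n) :=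
    (X ×ˢ Finset.univ).filter fun p => p.2 ∈ extensions p.1
  have hR : ∀ {p}, p ∈ R ↔ p.1 ∈ X ∧ p.2 ∉ p.1 ∧ IsPairMatching (insert p.2 p.1) := by
    intro p
    simp only [R, extensions, Finset.mem_filter, Finset.mem_product, Finset.mem_univ, true_and,
      and_true]
  have hRY : ∀ p ∈ R, insert p.2 p.1 ∈ Y := by
    intro p hp
    obtain ⟨h1, h2, h3⟩ := hR.mp hp
    exact mem_pairMatchings.mpr
      ⟨h3, by rw [Finset.card_insert_of_notMem h2, (mem_pairMatchings.mp h1).2]⟩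
  have hXR : X.card * m ≤ R.card := by
    have : R.card = ∑ M ∈ X, (extensions M).card := by
      rw [← Finset.card_sigma]
      refine Finset.card_bij' (fun p _ => ⟨p.1, p.2⟩) (fun p _ => (p.1, p.2)) ?_ ?_ ?_ ?_ <;>
        simp [R]
    rw [this, ← smul_eq_mul]
    exact Finset.card_nsmul_le_sum _ _ _ fun M hM => choose_le_card_extensions hM
  -- Deleting any one of the `j + 1` pairs of a matching in `Y` gives a relative in `X`.
  have hYR : Y.card * (j + 1) ≤ R.card := by
    have h1 : Y.card * (j + 1) = (Y.sigma fun N => N).card := by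
      rw [Finset.card_sigma, Finset.sum_congr rfl fun N hN => (mem_pairMatchings.mp hN).2,
        Finset.sum_const, smul_eq_mul]
    rw [h1]
    refine Finset.card_le_card_of_injOn (fun p => (p.1.erase p.2, p.2)) ?_ ?_
    · rintro ⟨N, e⟩ hp
      obtain ⟨hN, he⟩ := Finset.mem_sigma.mp hp
      obtain ⟨hN, hc⟩ := mem_pairMatchings.mp hN
      refine hR.mpr ⟨mem_pairMatchings.mpr ⟨hN.mono (Finset.erase_subset _ _), ?_⟩,
        Finset.notMem_erase _ _, ?_⟩
      · rw [Finset.card_erase_of_mem he, hc, Nat.add_sub_cancel]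
      · rwa [Finset.insert_erase he]
    · rintro ⟨N, e⟩ hp ⟨N', e'⟩ hp' heq
      simp only [Prod.mk.injEq] at heq
      obtain ⟨h1, rfl⟩ := heq
      have he := (Finset.mem_sigma.mp hp).2
      have he' := (Finset.mem_sigma.mp hp').2
      simp only at he he'
      rw [← Finset.insert_erase he, h1, Finset.insert_erase he']
  have hX0 : 0 < X.card := Finset.card_pos.mpr (pairMatchings_nonempty (by omega))
  have hR0 : (0 : ℝ) < R.card := by exact_mod_cast (Nat.mul_pos hX0 hm0).trans_le hXR
  have hm' : (0 : ℝ) < m := by exact_mod_cast hm0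
  have hk' : (0 : ℝ) < ((j + 1 : ℕ) : ℝ) := by exact_mod_cast hk
  set k : ℝ := ((j + 1 : ℕ) : ℝ) with hkdef
  have hs : 0 < √(m * k) := Real.sqrt_pos.mpr (by positivity)
  have hss : √(m * k) * √(m * k) = m * k := Real.mul_self_sqrt (by positivity)
  have key := A.card_le_of_relation hA graphOfPairs R X Y (fun p => p.1) (fun p => insert p.2 p.1)
    (fun p => p.2) ?_ ?_ (fun p hp => (hR.mp hp).1) hRY ?_ ?_
    -- This `c = √(m / k)` balances the bounds `|X| ≤ |R| / m` and `|Y| ≤ |R| / k`, so each query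
    -- lowers the progress sum by at most `2 * |R| / √(m * k)`.
    (c := m / √(m * k)) (by positivity)
  · have h1 : (X.card : ℝ) * m ≤ R.card := by exact_mod_cast hXR
    have h2 : (Y.card : ℝ) * k ≤ R.card := by
      rw [hkdef]; exact_mod_cast hYR
    have h3 : (m : ℝ) / √(m * k) * X.card + ((m : ℝ) / √(m * k))⁻¹ * Y.card ≤
        2 * R.card / √(m * k) := by
      have h4 : ((m : ℝ) / √(m * k))⁻¹ * Y.card = Y.card * k / √(m * k) := by
        rw [inv_div, div_mul_eq_mul_div, div_eq_div_iff hm'.ne' hs.ne']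
        linear_combination (Y.card : ℝ) * hss
      rw [h4, div_mul_eq_mul_div, ← add_div]
      gcongr
      linarith
    have h5 := key.trans (mul_le_mul_of_nonneg_left h3 (Nat.cast_nonneg _))
    rw [mul_div_assoc', le_div_iff₀ hs] at h5
    have h6 : (R.card : ℝ) * √(m * k) ≤ R.card * (36 * A.queries) := by linarith
    exact le_of_mul_le_mul_left h6 hR0
  · intro p _ f hf
    rw [Bool.eq_iff_iff, adjBit_graphOfPairs, adjBit_graphOfPairs, Finset.mem_insert]
    simp [hf]
  · intro p hp
    obtain ⟨h1, h2, h3⟩ := hR.mp hp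
    obtain ⟨h1, hc⟩ := mem_pairMatchings.mp h1
    rw [kMatching_graphOfPairs h1, kMatching_graphOfPairs h3, Finset.card_insert_of_notMem h2, hc]
    simp
  · rintro ⟨M, e⟩ _ ⟨M', e'⟩ _ h
    exact h
  · rintro ⟨M, e⟩ hp ⟨M', e'⟩ hp' h
    simp only [Prod.mk.injEq] at h
    obtain ⟨h1, rfl⟩ := h
    have he := (hR.mp hp).2.1
    have he' := (hR.mp hp').2.1
    simp only at he he'
    rw [← Finset.erase_insert he, h1, Finset.erase_insert he']

end MatchingLowerBound

/-! ### Assembling both bounds. -/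

section Main

theorem exists_algorithm_of_const {n : ℕ} {β : Type} {F : SimpleGraph (Fin n) → β}
    (e₀ : VertexPair n) (b : β) (h : ∀ G, F G = b) :
    ∃ A : QuantumQueryAlgorithm n β, A.queries = 0 ∧ A.Computes F := by
  let A : QuantumQueryAlgorithm n β :=
    { queries := 0
      workDim := 1
      init := (e₀, false, 0)
      U := fun _ => 1
      output := fun _ => b }
  refine ⟨A, rfl, fun G => ?_⟩
  have h1 : A.outputProb G (F G) = 1 := by
    rw [← A.sum_sq_state G A.queries, QuantumQueryAlgorithm.outputProb]
    exact Finset.sum_congr rfl fun x _ => if_pos (h G).symm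
  rw [h1]
  norm_num

theorem kMatching_zero {n : ℕ} (G : SimpleGraph (Fin n)) : kMatching n 0 G = true :=
  kMatching_eq_true (M := ∅) (by intro e he; simp at he) (by simp) (Nat.zero_le _)

theorem cube_le_of_le_rpow {A : ℝ} {n k : ℕ} (hk : (k : ℝ) ≤ A * (n : ℝ) ^ (2 / 3 : ℝ)) :
    (k : ℝ) ^ 3 ≤ A ^ 3 * (n : ℝ) ^ 2 := by
  have h1 : ((n : ℝ) ^ (2 / 3 : ℝ)) ^ 3 = (n : ℝ) ^ 2 := by
    rw [← Real.rpow_natCast, ← Real.rpow_mul (Nat.cast_nonneg n)]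
    norm_num
  calc (k : ℝ) ^ 3 ≤ (A * (n : ℝ) ^ (2 / 3 : ℝ)) ^ 3 := by gcongr
    _ = A ^ 3 * (n : ℝ) ^ 2 := by rw [mul_pow, h1]

theorem exists_algorithm_kMatching {A : ℝ} (hA : 0 < A) {n k : ℕ} (hn : 2 ≤ n)
    (hk : (k : ℝ) ≤ A * (n : ℝ) ^ (2 / 3 : ℝ)) :
    ∃ B : QuantumQueryAlgorithm n Bool, B.Computes (kMatching n k) ∧
      (B.queries : ℝ) ≤ (25 + 48 * √(A ^ 3)) * (√k * n) := by
  let e₀ : VertexPair n := ⟨s(⟨0, by omega⟩, ⟨1, by omega⟩), by simp⟩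
  rcases Nat.eq_zero_or_pos k with rfl | hk0
  · obtain ⟨B, hB, hB'⟩ := exists_algorithm_of_const e₀ true (kMatching_zero (n := n))
    exact ⟨B, hB', by simp [hB]⟩
  set W : ℝ := 2 * (√k * n) + 4 * k ^ 2 with hW
  have hW0 : 0 < W := by positivity
  obtain ⟨B, hB, hB'⟩ := (dualAdversary_kMatching (n := n) (by omega) hk0).exists_algorithm e₀
    (K := ⌈12 * W⌉₊) (Nat.ceil_pos.mpr (by positivity)) (Nat.le_ceil _)
  refine ⟨B, hB', ?_⟩
  rw [hB]
  have h1 : (⌈12 * W⌉₊ : ℝ) ≤ 12 * W + 1 := (Nat.ceil_lt_add_one (by positivity)).le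
  have hk1 : (1 : ℝ) ≤ k := by exact_mod_cast hk0
  have hn1 : (1 : ℝ) ≤ n := by exact_mod_cast (by omega : 1 ≤ n)
  have hsk : 1 ≤ √(k : ℝ) := Real.one_le_sqrt.mpr hk1
  have h2 : 1 ≤ √(k : ℝ) * n := one_le_mul_of_one_le_of_one_le hsk hn1
  have h3 : √(k : ℝ) * k ≤ √(A ^ 3) * n := by
    have h4 : √(k : ℝ) * k = √((k : ℝ) ^ 3) := by
      rw [show (k : ℝ) ^ 3 = k * k ^ 2 by ring, Real.sqrt_mul (by positivity),
        Real.sqrt_sq (by positivity)]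
    have h5 : √(A ^ 3) * n = √(A ^ 3 * (n : ℝ) ^ 2) := by
      rw [Real.sqrt_mul (by positivity), Real.sqrt_sq (by positivity)]
    rw [h4, h5]
    exact Real.sqrt_le_sqrt (cube_le_of_le_rpow hk)
  -- Only here does the upper bound use `k ≤ A n ^ (2/3)`: the exhaustive queries are absorbed into
  -- the search cost.
  have h6 : (k : ℝ) ^ 2 ≤ √(A ^ 3) * (√k * n) := by
    have h7 : (k : ℝ) ^ 2 = √k * (√k * k) := by
      rw [← mul_assoc, Real.mul_self_sqrt (by positivity), sq]
    rw [h7]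
    calc √(k : ℝ) * (√k * k) ≤ √k * (√(A ^ 3) * n) := by gcongr
      _ = √(A ^ 3) * (√k * n) := by ring
  linarith

theorem le_queries_kMatching {A : ℝ} (hA : 0 < A) {n k : ℕ}
    (hk : (k : ℝ) ≤ A * (n : ℝ) ^ (2 / 3 : ℝ)) (hkn : 2 * k ≤ n)
    (B : QuantumQueryAlgorithm n Bool) (hB : B.Computes (kMatching n k)) :
    min (1 / 108) (1 / (36 * (64 * A ^ 3) ^ 2)) * (√k * n) ≤ B.queries := by
  rcases Nat.eq_zero_or_pos k with rfl | hk0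
  · simp
  have hlow := sqrt_le_queries B hk0 hkn hB
  have hk1 : (1 : ℝ) ≤ k := by exact_mod_cast hk0
  have hn0 : (0 : ℝ) < n := by exact_mod_cast (by omega : 0 < n)
  rcases le_or_gt (4 * k) n with h4 | h4
  · have h1 : (n : ℝ) ^ 2 / 9 ≤ ((n - 2 * (k - 1)).choose 2 : ℕ) := by
      rw [Nat.cast_choose_two]
      have h2 : (n : ℝ) / 2 + 1 ≤ ((n - 2 * (k - 1) : ℕ) : ℝ) := by
        have : n + 2 ≤ 2 * (n - 2 * (k - 1)) := by omega
        have : (n : ℝ) + 2 ≤ 2 * ((n - 2 * (k - 1) : ℕ) : ℝ) := by exact_mod_cast this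
        linarith
      nlinarith
    have h2 : √(k : ℝ) * n / 3 ≤ √(((n - 2 * (k - 1)).choose 2 : ℕ) * (k : ℝ)) := by
      refine Real.le_sqrt_of_sq_le ?_
      rw [div_pow, mul_pow, Real.sq_sqrt (by positivity)]
      nlinarith
    calc min (1 / 108) (1 / (36 * (64 * A ^ 3) ^ 2)) * (√k * n) ≤ 1 / 108 * (√k * n) := by
          gcongr; exact min_le_left _ _
      _ ≤ B.queries := by linarith
  -- For `k > n / 4` the growth condition forces `n ≤ 64 * A ^ 3`; `√k * n` is then bounded in terms
  -- of `A`, and a constant lower bound on the number of queries suffices.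
  · have h1 : 1 ≤ √(((n - 2 * (k - 1)).choose 2 : ℕ) * (k : ℝ)) := by
      rw [Real.one_le_sqrt]
      refine one_le_mul_of_one_le_of_one_le ?_ hk1
      exact_mod_cast Nat.choose_pos (by omega : 2 ≤ n - 2 * (k - 1))
    have h2 : (n : ℝ) ≤ 64 * A ^ 3 := by
      have h3 : (n : ℝ) ≤ 4 * k := by exact_mod_cast h4.le
      have h5 : (n : ℝ) ^ 3 ≤ 64 * A ^ 3 * n ^ 2 := by
        calc (n : ℝ) ^ 3 ≤ (4 * k) ^ 3 := by gcongr
          _ ≤ 64 * A ^ 3 * n ^ 2 := by linarith [cube_le_of_le_rpow hk]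
      have h6 : 0 < (n : ℝ) ^ 2 := by positivity
      exact le_of_mul_le_mul_right (by linarith) h6
    have h3 : √(k : ℝ) ≤ n := by
      refine Real.sqrt_le_iff.mpr ⟨hn0.le, ?_⟩
      have h5 : (k : ℝ) ≤ n := by exact_mod_cast (by omega : k ≤ n)
      nlinarith
    calc min (1 / 108) (1 / (36 * (64 * A ^ 3) ^ 2)) * (√k * n)
        ≤ 1 / (36 * (64 * A ^ 3) ^ 2) * ((64 * A ^ 3) * (64 * A ^ 3)) := by
          gcongr
          · exact min_le_right _ _
          · exact h3.trans h2
      _ = 1 / 36 := by field_simp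
      _ ≤ B.queries := by linarith

end Main

/-- For every `A`, uniformly over all `n ≥ 2` and all `k ≤ A n^(2/3)`, the quantum query complexity
of `k`-matching is `Θ(√k n)`. The lower bound is for `2 k ≤ n` (for larger `k` no graph has such a
matching), which is automatic once `n ≥ 8 A^3`. -/
theorem mainTheorem8 :
    ∀ A : ℝ, 0 < A → ∃ c C : ℝ, 0 < c ∧ 0 < C ∧
      ∀ n k : ℕ, 2 ≤ n → (k : ℝ) ≤ A * (n : ℝ) ^ (2 / 3 : ℝ) →
        ∃ Q : ℕ, IsQuantumQueryComplexity (kMatching n k) Q ∧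
          (2 * k ≤ n → c * (Real.sqrt (k : ℝ) * (n : ℝ)) ≤ (Q : ℝ)) ∧
          (Q : ℝ) ≤ C * (Real.sqrt (k : ℝ) * (n : ℝ)) := by
  intro A hA
  refine ⟨min (1 / 108) (1 / (36 * (64 * A ^ 3) ^ 2)), 25 + 48 * √(A ^ 3), by positivity,
    by positivity, fun n k hn hk => ?_⟩
  obtain ⟨B, hB, hBle⟩ := exists_algorithm_kMatching hA hn hk
  have hne : {T : ℕ | ∃ B : QuantumQueryAlgorithm n Bool, B.queries = T ∧
      B.Computes (kMatching n k)}.Nonempty := ⟨B.queries, B, rfl, hB⟩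
  refine ⟨sInf _, ⟨Nat.sInf_mem hne, fun T hT => Nat.sInf_le hT⟩, fun hkn => ?_, ?_⟩
  · obtain ⟨B', hq, hB'⟩ := Nat.sInf_mem hne
    rw [← hq]
    exact le_queries_kMatching hA hk hkn B' hB'
  · have : sInf {T : ℕ | ∃ B : QuantumQueryAlgorithm n Bool, B.queries = T ∧
        B.Computes (kMatching n k)} ≤ B.queries := Nat.sInf_le ⟨B, rfl, hB⟩
    exact (Nat.cast_le.mpr this).trans hBle
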